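/- Notation. Let $w=e^{2\pi i/3}$, let $*$ denote (entrywise) complex conjugation, and let $e_{i,j}$ be the $3\times 3$ matrix units on $\mathbb C^3$ with indices read modulo $3$ (on $\mathbb C^2$ we write $e_{11},e_{12},e_{21},e_{22}$ for the $2\times2$ matrix units). On $\mathbb C^2\otimes\mathbb C^3$ put $$L(z)=\sum_{i=1}^{3}\Big\{(w^{1-i}e_{12}+w^{i-1}e_{21})\otimes e_{i,i}+z\,[\,e_{11}\otimes e_{i-1,i}+e_{22}\otimes e_{i+1,i}\,]\Big\},$$ $$\bar L(z)=\sum_{i=1}^{3}\Big\{[\,e_{11}\otimes e_{i+1,i}+e_{22}\otimes e_{i-1,i}\,]+z\,(w^{1-i}e_{12}+w^{i-1}e_{21})\otimes e_{i,i}\Big\},$$ and on $\mathbb C^3\otimes\mathbb C^3$ put $$R(z_1,z_2)=N(z_1,z_2)\sum_{a,i,j=1}^{3}\Big[\sum_{b=1}^{3}w^{2a(b+j)}\,\overline W(z_1|b)\,\overline W(z_2^{-1}|b-j)\Big]e_{i+j,i+a}\otimes e_{i+a+j,i},$$ where $\overline W(z|l)=1$ if $l\equiv0\bmod 3$, $\overline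 W(z|l)=\frac{z-1}{wz-w^2}$ otherwise, and $N(z_1,z_2)=-\frac13(wz_1-w^2)(w-w^2z_2)$; the entries of $R$ are polynomials in $z_1,z_2$, which defines $R$ everywhere, in particular at $(0,0)$. For a chain of $\mathcal L$ sites with space $(\mathbb C^3)^{\otimes\mathcal L}$ and an auxiliary space $V_0$ ($=\mathbb C^2$ for $t^{(2,m)}$, $=\mathbb C^3$ for $t^{(3,m)}$), let the subscripts $0k$ mean that the first tensor factor is $V_0$ and the second one is site $k$ (and conversely for $k0$). The transfer matrices for periodic ($m=p$), braided closed ($m=b$) and open ($m=o$) boundary conditions are $$\begin{aligned} t^{(2,p)}(z)&=\mathrm{tr}_0[L_{0\mathcal L}(z)\cdots L_{01}(z)], & t^{(3,p)}(z_1,z_2)&=\mathrm{tr}_0[R_{0\mathcal L}(z_1,z_2)\cdots R_{01}(z_1,z_2)],\\ t^{(2,b)}(z)&=\mathrm{tr}_0[L_{0\mathcal L}(z)\cdots L_{01}(z)L_{01}(0)\cdots L_{0\mathcal L}(0)], & t^{(3,b)}(z_1,z_2)&=\mathrm{tr}_0[R_{0\mathcal L}(z_1,z_2)\cdots R_{01}(z_1,z_2)R_{01}(0,0)\cdots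 R_{0\mathcal L}(0,0)],\\ t^{(2,o)}(z)&=\mathrm{tr}_0[L_{0\mathcal L}(z)\cdots L_{01}(z)\bar L_{01}(z)\cdots \bar L_{0\mathcal L}(z)], & t^{(3,o)}(z_1,z_2)&=\mathrm{tr}_0[R_{0\mathcal L}(z_1,z_2)\cdots R_{01}(z_1,z_2)R_{10}(z_1,z_2)\cdots R_{\mathcal L0}(z_1,z_2)]. \end{aligned}$$ Further let $$f^{(p)}(z)=(w^2z+1)^{\mathcal L},\quad g^{(p)}(z)=(wz-1)^{\mathcal L},\quad f^{(b)}(z)=(1+w^2z)^{\mathcal L},\quad g^{(b)}(z)=(1-wz)^{\mathcal L},$$ $$f^{(o)}(z)=\tfrac{(1+w^2z^2)(1-wz^2)}{1-z^4}(1+w^2z)^{2\mathcal L},\qquad g^{(o)}(z)=(-1)^{\mathcal L}\tfrac{(1-w^2z^2)(1+wz^2)}{1-z^4}(1-wz)^{2\mathcal L},$$ and let $D^{(p)}=D^{(b)}=\mathcal L$, $D^{(o)}=2\mathcal L$ (the bound on the degree of $t^{(3,m)}(z_1,z_2)$ in each variable). Proposition. Fix $m\in\{p,b,o\}$ and $\mathcal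 L$. Let $\lambda_j(z)$ and $\lambda_k(z)$ be eigenvalues of $t^{(2,m)}(z)$, i.e. functions $\lambda$ of $z\in\mathbb C$ for which there is a nonzero vector $u$, independent of $z$, with $t^{(2,m)}(z)u=\lambda(z)u$ for all $z\in\mathbb C$. Let $\phi_j,\phi_k$ be monic polynomials of degree at most $D^{(m)}$ that satisfy the TQ relations $$\lambda_l(z)\phi_l(wz)=f^{(m)}(z)\phi_l(w^2z)+g^{(m)}(z)\phi_l(z)\qquad(l=j,k)$$ for all $z\in\mathbb C$ (with $z^4\neq1$ if $m=o$). Suppose that a nonzero vector $v$ satisfies $$t^{(2,m)}(z)v=\lambda_j(z)v\ (z\in\mathbb C),\qquad [t^{(2,m)}(x)]^*v=\lambda_k(x)v\ (x\in\mathbb R),\qquad t^{(3,m)}(z_1,z_2)v=\Lambda(z_1,z_2)v\ (z_1,z_2\in\mathbb C).$$ Then there is a constant $c\in\mathbb C$ (which may depend on $v$, not only on $j$ and $k$) such that $$\Lambda(z_1,z_2)=c\,\phi_j(z_1)\,[\phi_k(z_2)]^*\qquad\text{for all } z_1,z_2\in\mathbb R.$$ -/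

import Mathlib

noncomputable section

namespace AnyonChain

open Matrix
open scoped Kronecker

/-- The three types of boundary conditions: periodic, braided closed, open. -/
inductive Boundary where
  | periodic
  | braided
  | openEnds

/-- The primitive cube root of unity `exp (2 π i / 3)`. -/
def ω : ℂ := Complex.exp (2 * Real.pi * Complex.I / 3)

/-- The matrix units of the local three-dimensional space. The basis vectors `1, 2, 3` are indexed
by their residues modulo `3`. -/
def e3 (i j : ZMod 3) : Matrix (ZMod 3) (ZMod 3) ℂ := Matrix.single i j 1

/-- The matrix units of the two-dimensional auxiliary space; the basis vectors `1, 2` are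
indexed by `0, 1`. -/
def e2 (i j : Fin 2) : Matrix (Fin 2) (Fin 2) ℂ := Matrix.single i j 1

/-- `ω` raised to a residue class modulo `3`, which is legitimate as `ω ^ 3 = 1`. -/
def ωpow (i : ZMod 3) : ℂ := ω ^ i.val

/-- The `L`-operator
`∑ i, (ω^(1-i) e₁₂ + ω^(i-1) e₂₁) ⊗ e_{i,i} + z (e₁₁ ⊗ e_{i-1,i} + e₂₂ ⊗ e_{i+1,i})`,
auxiliary space first. -/
def Lop (z : ℂ) : Matrix (Fin 2 × ZMod 3) (Fin 2 × ZMod 3) ℂ :=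
  ∑ i : ZMod 3, ((ωpow (1 - i) • e2 0 1 + ωpow (i - 1) • e2 1 0) ⊗ₖ e3 i i
    + z • (e2 0 0 ⊗ₖ e3 (i - 1) i + e2 1 1 ⊗ₖ e3 (i + 1) i))

/-- The second `L`-operator used for open boundary conditions,
`∑ i, (e₁₁ ⊗ e_{i+1,i} + e₂₂ ⊗ e_{i-1,i}) + z (ω^(1-i) e₁₂ + ω^(i-1) e₂₁) ⊗ e_{i,i}`. -/
def Lbar (z : ℂ) : Matrix (Fin 2 × ZMod 3) (Fin 2 × ZMod 3) ℂ :=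
  ∑ i : ZMod 3, ((e2 0 0 ⊗ₖ e3 (i + 1) i + e2 1 1 ⊗ₖ e3 (i - 1) i)
    + z • ((ωpow (1 - i) • e2 0 1 + ωpow (i - 1) • e2 1 0) ⊗ₖ e3 i i))

/-- The weight `W̄(z|l)`. -/
def Wbar (z : ℂ) (l : ZMod 3) : ℂ := if l = 0 then 1 else (z - 1) / (ω * z - ω ^ 2)

/-- The normalisation `N(z₁,z₂)`. -/
def Nfac (z₁ z₂ : ℂ) : ℂ := -(1 / 3) * (ω * z₁ - ω ^ 2) * (ω - ω ^ 2 * z₂)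

/-- `(ω z - ω²) W̄(z|l)` with the denominator cleared. -/
def wt₁ (z : ℂ) (l : ZMod 3) : ℂ := if l = 0 then ω * z - ω ^ 2 else z - 1

/-- `(ω - ω² z) W̄(z⁻¹|l)` with the denominator cleared. -/
def wt₂ (z : ℂ) (l : ZMod 3) : ℂ := if l = 0 then ω - ω ^ 2 * z else 1 - z

/-- The two-parameter `R`-matrix, in the polynomial form in which its value at `(0,0)` makes sense;
`Rmat_eq` is the form with the weights `W̄`. -/
def Rmat (z₁ z₂ : ℂ) : Matrix (ZMod 3 × ZMod 3) (ZMod 3 × ZMod 3) ℂ :=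
  ∑ a : ZMod 3, ∑ i : ZMod 3, ∑ j : ZMod 3,
    (-(1 / 3) * ∑ b : ZMod 3, ωpow (2 * a * (b + j)) * wt₁ z₁ b * wt₂ z₂ (b - j)) •
      (e3 (i + j) (i + a) ⊗ₖ e3 (i + a + j) i)

lemma wt₁_eq {z : ℂ} (hz : ω * z - ω ^ 2 ≠ 0) (l : ZMod 3) :
    wt₁ z l = (ω * z - ω ^ 2) * Wbar z l := by
  unfold wt₁ Wbar
  split_ifs
  · ring
  · rw [mul_div_assoc', eq_div_iff hz]
    ring

lemma wt₂_eq {z : ℂ} (h0 : z ≠ 0) (hz : ω - ω ^ 2 * z ≠ 0) (l : ZMod 3) :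
    wt₂ z l = (ω - ω ^ 2 * z) * Wbar z⁻¹ l := by
  unfold wt₂ Wbar
  split_ifs
  · ring
  · have h : ω * z⁻¹ - ω ^ 2 = (ω - ω ^ 2 * z) * z⁻¹ := by field_simp
    rw [h, mul_div_assoc', eq_div_iff (mul_ne_zero hz (inv_ne_zero h0))]
    have h' : z * z⁻¹ = 1 := mul_inv_cancel₀ h0
    linear_combination (ω - ω ^ 2 * z) * (-1) * h'

theorem Rmat_eq {z₁ z₂ : ℂ} (h₁ : ω * z₁ - ω ^ 2 ≠ 0) (h0 : z₂ ≠ 0)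
    (h₂ : ω - ω ^ 2 * z₂ ≠ 0) :
    Rmat z₁ z₂ = Nfac z₁ z₂ • ∑ a : ZMod 3, ∑ i : ZMod 3, ∑ j : ZMod 3,
      (∑ b : ZMod 3, ωpow (2 * a * (b + j)) * Wbar z₁ b * Wbar z₂⁻¹ (b - j)) •
        (e3 (i + j) (i + a) ⊗ₖ e3 (i + a + j) i) := by
  unfold Rmat
  simp only [Finset.smul_sum, smul_smul]
  refine Finset.sum_congr rfl fun a _ => Finset.sum_congr rfl fun i _ =>
    Finset.sum_congr rfl fun j _ => ?_
  congr 1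
  rw [Finset.mul_sum, Finset.mul_sum]
  refine Finset.sum_congr rfl fun b _ => ?_
  rw [wt₁_eq h₁, wt₂_eq h0 h₂, Nfac]
  ring

/-- Basis configurations of a chain with `n` sites; vectors of the chain are functions on them. -/
abbrev Config (n : ℕ) : Type := Fin n → ZMod 3

/-- `M_{0k}`: the operator `M` acting on the auxiliary space and on site `k` of the chain, and
as the identity on all other sites. -/
def onSite {A : Type} {n : ℕ} (M : Matrix (A × ZMod 3) (A × ZMod 3) ℂ) (k : Fin n) :
    Matrix (A × Config n) (A × Config n) ℂ :=
  Matrix.of fun p q =>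
    if ∀ l, l ≠ k → p.2 l = q.2 l then M (p.1, p.2 k) (q.1, q.2 k) else 0

/-- The product `M_{0n} ⋯ M_{01}`. -/
def prodDown {A : Type} [Fintype A] [DecidableEq A] (n : ℕ)
    (M : Matrix (A × ZMod 3) (A × ZMod 3) ℂ) : Matrix (A × Config n) (A × Config n) ℂ :=
  ((List.finRange n).reverse.map (onSite M)).prod

/-- The product `M_{01} ⋯ M_{0n}`. -/
def prodUp {A : Type} [Fintype A] [DecidableEq A] (n : ℕ)
    (M : Matrix (A × ZMod 3) (A × ZMod 3) ℂ) : Matrix (A × Config n) (A × Config n) ℂ :=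
  ((List.finRange n).map (onSite M)).prod

/-- The partial trace over the auxiliary space. -/
def traceAux {A : Type} [Fintype A] {n : ℕ} (T : Matrix (A × Config n) (A × Config n) ℂ) :
    Matrix (Config n) (Config n) ℂ :=
  Matrix.of fun s u => ∑ a : A, T (a, s) (a, u)

/-- The transfer matrix with two-dimensional auxiliary space. -/
def t2 (m : Boundary) (n : ℕ) (z : ℂ) : Matrix (Config n) (Config n) ℂ :=
  match m with
  | .periodic => traceAux (prodDown n (Lop z))
  | .braided => traceAux (prodDown n (Lop z) * prodUp n (Lop 0))
  | .openEnds => traceAux (prodDown n (Lop z) * prodUp n (Lbar z))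

/-- The transfer matrix with three-dimensional auxiliary space. In the open case the second half
is `R_{10} ⋯ R_{n0}`, in which the first tensor factor of `R` is the site and the second one is
the auxiliary space. -/
def t3 (m : Boundary) (n : ℕ) (z₁ z₂ : ℂ) : Matrix (Config n) (Config n) ℂ :=
  match m with
  | .periodic => traceAux (prodDown n (Rmat z₁ z₂))
  | .braided => traceAux (prodDown n (Rmat z₁ z₂) * prodUp n (Rmat 0 0))
  | .openEnds => traceAux (prodDown n (Rmat z₁ z₂) *
      prodUp n ((Rmat z₁ z₂).submatrix Prod.swap Prod.swap))

/-- The coefficient `f` of the TQ relation. -/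
def fcoef (m : Boundary) (n : ℕ) (z : ℂ) : ℂ :=
  match m with
  | .periodic => (ω ^ 2 * z + 1) ^ n
  | .braided => (1 + ω ^ 2 * z) ^ n
  | .openEnds => (1 + ω ^ 2 * z ^ 2) * (1 - ω * z ^ 2) / (1 - z ^ 4) * (1 + ω ^ 2 * z) ^ (2 * n)

/-- The coefficient `g` of the TQ relation. -/
def gcoef (m : Boundary) (n : ℕ) (z : ℂ) : ℂ :=
  match m with
  | .periodic => (ω * z - 1) ^ n
  | .braided => (1 - ω * z) ^ n
  | .openEnds => (-1) ^ n * ((1 - ω ^ 2 * z ^ 2) * (1 + ω * z ^ 2) / (1 - z ^ 4)) *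
      (1 - ω * z) ^ (2 * n)

/-- The points at which the coefficients `f` and `g` are defined. -/
def IsRegular (m : Boundary) (z : ℂ) : Prop :=
  match m with
  | .periodic => True
  | .braided => True
  | .openEnds => z ^ 4 ≠ 1

/-- The set of eigenvalues of the transfer matrix `t2`, as functions of the spectral parameter; the
eigenvectors do not depend on the spectral parameter. -/
def eigenvalues (m : Boundary) (n : ℕ) : Set (ℂ → ℂ) :=
  {lam | ∃ u : Config n → ℂ, u ≠ 0 ∧ ∀ z : ℂ, t2 m n z *ᵥ u = lam z • u}

/-- The bound on the degree of the transfer matrix `t3` in each of its two variables. -/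
def degBound (m : Boundary) (n : ℕ) : ℕ :=
  match m with
  | .periodic => n
  | .braided => n
  | .openEnds => 2 * n

/-- The TQ relation `λ(z) φ(ω z) = f(z) φ(ω² z) + g(z) φ(z)`. -/
def TQ (m : Boundary) (n : ℕ) (lam : ℂ → ℂ) (φ : Polynomial ℂ) : Prop :=
  ∀ z : ℂ, IsRegular m z →
    lam z * φ.eval (ω * z) = fcoef m n z * φ.eval (ω ^ 2 * z) + gcoef m n z * φ.eval z

end AnyonChain

end

noncomputable section

namespace AnyonChain

open Matrix
open scoped Kronecker

/-! ### The cube root of unity. -/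

section RootOfUnity

/-! The fusion identity `t2_mul_t3`, t2(z) t3(ωz, z₂) = f(z) t3(ω²z, z₂) + g(z) t3(z, z₂), applied
to v, says that for fixed z₂ the polynomial Λ(·, z₂), of degree at most D, solves the same TQ
relation as φ_j. Once such solutions are known to be unique up to scalars (`TQ.unique`), Λ(z₁, z₂) =
a(z₂) φ_j(z₁). Conjugating t3 exchanges and conjugates its arguments (`t3_map_conj`), and
eigenvalues of t2 are real on the real line (`isHermitian_t2`). So the conjugate of v is an
eigenvector of t2 with eigenvalue λ_k, and the same argument factors φ_k(z₂)* out of Λ at real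
points. Comparing the two factorisations separates the variables.

Fusion (`fusion`): on the product of the two auxiliary spaces, L(z)R(ωz) leaves a three-dimensional
subspace invariant, and both there and on the quotient it is a multiple of an R-matrix. In a double
row the factors meet in the wrong order; a linear map Θ on operators of the auxiliary pair moves R
past L'.

Uniqueness: the TQ relation is a second-order difference equation along the three-point orbits of z
↦ ωz. The Casoratian of two solutions obeys a first-order recurrence with nontrivial monodromy
(`gap` is nonzero), so it vanishes and the quotient of two solutions is a function of z³. Uniqueness
then follows if every nonzero solution has degree at least the bound minus two
(`IsSolution.le_natDegree`).

For that bound let b be the fused eigenvalue. Reality gives n(z³) χ χ̄ = m(z³) b with n, m coprime.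
A root of n would make b vanish on a whole orbit, or to third order at 0. The determinant identity
for b excludes 0, by a real quadratic without real roots when δ = 1, and elsewhere it forces `gap`
to vanish, which is excluded by a valuation above 2 together with integrality of the eigenvalue. So
n is constant, 2 deg χ ≥ deg b, and the same determinant identity bounds deg b from below. -/

lemma ω_isPrimitiveRoot : IsPrimitiveRoot ω 3 := by
  have h := Complex.isPrimitiveRoot_exp 3 (by norm_num)
  simpa [ω] using h

lemma ω_pow_three : ω ^ 3 = 1 := ω_isPrimitiveRoot.pow_eq_one

lemma ω_ne_zero : ω ≠ 0 := ω_isPrimitiveRoot.ne_zero (by norm_num)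

lemma ω_ne_one : ω ≠ 1 := ω_isPrimitiveRoot.ne_one (by norm_num)

lemma ω_sq_add : ω ^ 2 + ω + 1 = 0 := by
  have h : (ω - 1) * (ω ^ 2 + ω + 1) = 0 := by linear_combination ω_pow_three
  exact (mul_eq_zero.mp h).resolve_left (sub_ne_zero.mpr ω_ne_one)

lemma conj_ω : starRingEnd ℂ ω = ω ^ 2 := by
  have h : starRingEnd ℂ ω * ω = 1 := by
    rw [mul_comm, Complex.mul_conj, Complex.normSq_eq_norm_sq,
      ω_isPrimitiveRoot.norm'_eq_one (by norm_num)]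
    simp
  have h3 := ω_pow_three
  have : starRingEnd ℂ ω = starRingEnd ℂ ω * ω ^ 3 := by rw [h3, mul_one]
  rw [this]
  linear_combination ω ^ 2 * h

end RootOfUnity

/-! ### Roots of unity and a valuation above 2. -/

section DyadicValuation

/-- The complex numbers carry a valuation above the prime two. -/
lemma exists_valuation_two_lt_one :
    ∃ B : ValuationSubring ℂ, B.valuation 2 < 1 := by
  -- In the copy of ℤ inside ℂ the ideal (2) is proper, so some valuation subring of ℂ has it among
  -- its nonunits.
  have h2 : Ideal.span {(2 : (Int.castRingHom ℂ).range)} ≠ ⊤ := by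
    rw [Ne, Ideal.span_singleton_eq_top]
    intro h
    obtain ⟨⟨b, m, rfl⟩, hb⟩ := isUnit_iff_exists_inv.mp h
    have h1 : (2 : ℂ) * (m : ℂ) = 1 := congrArg Subtype.val hb
    have h3 : (2 : ℤ) * m = 1 := by exact_mod_cast h1
    omega
  obtain ⟨B, -, hB⟩ := Ideal.image_subset_nonunits_valuationSubring _ h2
  exact ⟨B, hB ⟨2, Ideal.subset_span rfl, rfl⟩⟩

variable {Γ : Type*} [LinearOrderedCommGroupWithZero Γ] (v : Valuation ℂ Γ)

lemma valuation_natCast_le_one (m : ℕ) : v (m : ℂ) ≤ 1 := by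
  induction m with
  | zero => simp
  | succ m ih =>
    rw [Nat.cast_succ]
    exact v.map_add_le ih (by simp)

lemma valuation_ω : v ω = 1 := by
  have h : v ω ^ 3 = 1 := by rw [← map_pow, ω_pow_three, map_one]
  exact (pow_eq_one_iff_of_nonneg zero_le (by norm_num)).mp h

lemma valuation_eq_one_of_sub_lt {x y : ℂ} (hx : v x = 1) (h : v (y - x) < 1) : v y = 1 := by
  have := v.map_add_eq_of_lt_right (x := y - x) (y := x) (by rwa [hx])
  rwa [sub_add_cancel, hx] at this

/-- A root of unity that is congruent to one modulo two is one or minus one. -/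
lemma eq_zero_or_eq_neg_one_of_one_add_two_mul_pow (h2 : v 2 < 1) (k : ℕ) (hk : k ≠ 0) :
    ∀ t : ℂ, v t ≤ 1 → (1 + 2 * t) ^ k = 1 → t = 0 ∨ t = -1 := by
  induction k using Nat.strong_induction_on with
  | _ k ih =>
    intro t ht hpow
    have h2t : v (2 * t) < 1 := by
      rw [map_mul]
      exact mul_lt_one_of_lt_of_le h2 ht
    rcases Nat.even_or_odd' k with ⟨m, rfl | rfl⟩
    -- Even exponent: squaring keeps the form 1 + 2t', with t' = 2(t + t²). Since v t' < 1, the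
    -- alternative t' = -1 is impossible, and t' = 0 gives t(t + 1) = 0.
    · have hm : m ≠ 0 := by rintro rfl; simp at hk
      have ht2 : v (2 * (t + t ^ 2)) < 1 := by
        rw [map_mul]
        refine mul_lt_one_of_lt_of_le h2 (v.map_add_le ht ?_)
        rw [map_pow]
        exact pow_le_one₀ zero_le ht
      have hpow' : (1 + 2 * (2 * (t + t ^ 2))) ^ m = 1 := by
        rwa [pow_mul, show (1 + 2 * t) ^ 2 = 1 + 2 * (2 * (t + t ^ 2)) by ring] at hpow
      rcases ih m (by omega) hm _ ht2.le hpow' with h | h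
      · have : t * (t + 1) = 0 := by linear_combination h / 2
        rcases mul_eq_zero.mp this with h | h
        · exact Or.inl h
        · exact Or.inr (by linear_combination h)
      · rw [h] at ht2
        simp at ht2
    -- Odd exponent: 2t times a geometric sum vanishes. The sum is congruent to its number of terms
    -- 2m + 1, hence to 1, so it is not zero.
    · left
      have hg := mul_geom_sum (1 + 2 * t) (2 * m + 1)
      rw [hpow, sub_self, add_sub_cancel_left] at hg
      rcases mul_eq_zero.mp hg with h | h
      · simpa using h
      · exfalso
        have hlt : v (∑ i ∈ Finset.range (2 * m + 1), ((1 + 2 * t) ^ i - 1)) < 1 := by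
          refine v.map_sum_lt one_ne_zero fun i _ => ?_
          rw [← mul_geom_sum, add_sub_cancel_left, map_mul]
          refine mul_lt_one_of_lt_of_le h2t (v.map_sum_le fun j _ => ?_)
          rw [map_pow]
          exact pow_le_one₀ zero_le (v.map_add_le (by simp) h2t.le)
        have h1 : v (∑ i ∈ Finset.range (2 * m + 1), (1 + 2 * t) ^ i) = 1 := by
          refine valuation_eq_one_of_sub_lt v (x := 1) (map_one v) ?_
          have : ∑ i ∈ Finset.range (2 * m + 1), (1 + 2 * t) ^ i - 1 =
              ∑ i ∈ Finset.range (2 * m + 1), ((1 + 2 * t) ^ i - 1) + 2 * (m : ℂ) := by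
            rw [Finset.sum_sub_distrib]
            simp
            ring
          rw [this]
          refine v.map_add_lt hlt ?_
          rw [map_mul]
          exact mul_lt_one_of_lt_of_le h2 (valuation_natCast_le_one v m)
        rw [h, map_zero] at h1
        exact zero_ne_one h1

/-- Eigenvalues of a matrix with integral entries are integral. -/
lemma valuation_eigenvalue_le_one {ι : Type*} [Fintype ι] {M : Matrix ι ι ℂ}
    (hM : ∀ i j, v (M i j) ≤ 1) {u : ι → ℂ} (hu : u ≠ 0) {μ : ℂ} (h : M *ᵥ u = μ • u) :
    v μ ≤ 1 := by
  obtain ⟨i₀, hi₀⟩ := Function.ne_iff.mp hu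
  obtain ⟨i, -, hi⟩ := Finset.exists_max_image Finset.univ (fun i => v (u i))
    ⟨i₀, Finset.mem_univ _⟩
  have hpos : 0 < v (u i) :=
    lt_of_lt_of_le (by simpa [zero_lt_iff] using hi₀) (hi i₀ (Finset.mem_univ _))
  have h1 : v μ * v (u i) ≤ 1 * v (u i) := by
    have : μ * u i = ∑ j, M i j * u j := by
      have := congrFun h i
      simpa [mulVec, dotProduct] using this.symm
    rw [← map_mul, this, one_mul]
    refine v.map_sum_le fun j _ => ?_
    rw [map_mul]
    exact (mul_le_mul' (hM i j) (hi j (Finset.mem_univ _))).trans (one_mul _).le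
  exact le_of_mul_le_mul_right h1 hpos

/-- If the third power of `a` is congruent to one modulo the maximal ideal, then so is `a`, up to
a cube root of unity. -/
lemma exists_valuation_ω_pow_mul_sub_one_lt {a : ℂ} (h : v (a ^ 3 - 1) < 1) :
    ∃ k : ℕ, v (ω ^ k * a - 1) < 1 := by
  by_contra! hk
  have h1 : a ^ 3 - 1 = (ω ^ 0 * a - 1) * (ω ^ 1 * a - 1) * (ω ^ 2 * a - 1) := by
    linear_combination (a ^ 2 - a) * ω_sq_add + (- a^3 + a ^ 2) * ω_pow_three
  rw [h1, map_mul, map_mul] at h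
  exact absurd h (not_lt.mpr (one_le_mul (one_le_mul (hk 0) (hk 1)) (hk 2)))

/-- The solutions `y` of `(1 + y) ^ k = (1 - y) ^ k` that are not congruent to one vanish. -/
lemma eq_zero_of_one_add_pow_eq_one_sub_pow (h2 : v 2 < 1) {k : ℕ} (hk : k ≠ 0) {y : ℂ}
    (hy : 1 ≤ v (y - 1)) (h : (1 + y) ^ k = (1 - y) ^ k) (hev : Even k) : y = 0 := by
  have hne : y - 1 ≠ 0 := by
    intro h0
    rw [h0, map_zero] at hy
    exact absurd hy (by simp)
  -- (1 + y)/(y - 1) = 1 + 2/(y - 1) is a root of unity congruent to 1 modulo 2, hence ±1; the value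
  -- -1 means y = 0. Evenness of k absorbs the sign of y - 1.
  have hpow : (1 + 2 * (y - 1)⁻¹) ^ k = 1 := by
    have : 1 + 2 * (y - 1)⁻¹ = (1 + y) / (y - 1) := by field_simp; ring
    rw [this, div_pow, h, ← hev.neg_pow, neg_sub, div_self (pow_ne_zero _ hne)]
  have hv : v (y - 1)⁻¹ ≤ 1 := by
    rw [map_inv₀]
    exact inv_le_one_of_one_le₀ hy
  rcases eq_zero_or_eq_neg_one_of_one_add_two_mul_pow v h2 k hk _ hv hpow with h0 | h0
  · exact absurd h0 (inv_ne_zero hne)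
  · rw [inv_eq_iff_eq_inv] at h0
    norm_num at h0
    linear_combination h0

end DyadicValuation

/-! ### Rotation and conjugation of polynomials. -/

section Rotation
open Polynomial

/-- The substitution `X ↦ ω X`. -/
def rot : ℂ[X] →+* ℂ[X] := compRingHom (C ω * X)

/-- Complex conjugation of the coefficients. -/
def conjPoly : ℂ[X] →+* ℂ[X] := mapRingHom (starRingEnd ℂ)

lemma rot_X : rot X = C ω * X := by simp [rot]

lemma rot_C (c : ℂ) : rot (C c) = C c := by simp [rot]

lemma coeff_rot (P : ℂ[X]) (n : ℕ) : (rot P).coeff n = P.coeff n * ω ^ n := by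
  simp [rot, comp_C_mul_X_coeff]

lemma eval_rot (P : ℂ[X]) (z : ℂ) : (rot P).eval z = P.eval (ω * z) := by
  simp [rot, eval_comp]

lemma rot_rot_rot (P : ℂ[X]) : rot (rot (rot P)) = P := by
  ext n
  simp only [coeff_rot]
  have : (ω ^ n) ^ 3 = 1 := by rw [← pow_mul, mul_comm, pow_mul, ω_pow_three, one_pow]
  linear_combination P.coeff n * this

lemma natDegree_rot (P : ℂ[X]) : (rot P).natDegree = P.natDegree := by
  simp [rot, natDegree_comp, natDegree_C_mul_X _ ω_ne_zero]

lemma rot_ne_zero {P : ℂ[X]} (h : P ≠ 0) : rot P ≠ 0 := by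
  intro h0
  apply h
  rw [← rot_rot_rot P, h0, map_zero, map_zero]

lemma coeff_conjPoly (P : ℂ[X]) (n : ℕ) :
    (conjPoly P).coeff n = starRingEnd ℂ (P.coeff n) := by
  simp [conjPoly]

lemma conjPoly_ne_zero {P : ℂ[X]} (h : P ≠ 0) : conjPoly P ≠ 0 := by
  simpa [conjPoly] using h

lemma natDegree_conjPoly (P : ℂ[X]) : (conjPoly P).natDegree = P.natDegree := by
  simp [conjPoly]

/-- Conjugation inverts ω, so it turns the rotation into its inverse, which is its square. -/
lemma conjPoly_rot (P : ℂ[X]) : conjPoly (rot P) = rot (rot (conjPoly P)) := by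
  ext n
  simp only [coeff_rot, coeff_conjPoly, map_mul, map_pow, conj_ω]
  ring

lemma exists_expand_of_rot_eq_self {P : ℂ[X]} (h : rot P = P) : ∃ N, P = expand ℂ 3 N := by
  refine ⟨contract 3 P, ?_⟩
  ext n
  rw [coeff_expand (by norm_num)]
  split_ifs with hn
  · rw [coeff_contract (by norm_num), Nat.div_mul_cancel hn]
  · have h1 := congrArg (fun Q => Q.coeff n) h
    simp only [coeff_rot] at h1
    have h2 : ω ^ n ≠ 1 := fun h0 => hn ((ω_isPrimitiveRoot.pow_eq_one_iff_dvd n).mp h0)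
    have h3 : P.coeff n * (ω ^ n - 1) = 0 := by linear_combination h1
    exact (mul_eq_zero.mp h3).resolve_right (sub_ne_zero.mpr h2)

lemma rot_expand (N : ℂ[X]) : rot (expand ℂ 3 N) = expand ℂ 3 N := by
  ext n
  rw [coeff_rot, coeff_expand (by norm_num)]
  split_ifs with hn
  · rw [(ω_isPrimitiveRoot.pow_eq_one_iff_dvd n).mpr hn, mul_one]
  · simp

end Rotation

/-! ### The second-order difference equation on three-point orbits. -/

section DifferenceEquation
open Polynomial

/-- The polynomial solutions of the second order difference equation with coefficients `F`, `G`
and eigenvalue `l`. -/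
def IsSolution (F G l χ : ℂ[X]) : Prop :=
  l * rot χ = rot (rot F) * rot (rot χ) + rot G * χ

/-- The difference of the products of the coefficients over an orbit of the rotation. -/
def gap (F G : ℂ[X]) : ℂ[X] := F * rot F * rot (rot F) - G * rot G * rot (rot G)

/-- The fused eigenvalue. -/
def fused (F G l : ℂ[X]) : ℂ[X] := rot F * rot (rot F) + G * l

variable {F G l χ : ℂ[X]}

/-- Together with its two rotations the equation is a cyclic homogeneous system of three equations
in χ, `rot χ`, `rot (rot χ)`. -/
lemma IsSolution.rot_eq (h : IsSolution F G l χ) :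
    rot l * rot (rot χ) = F * χ + rot (rot G) * rot χ := by
  have := congrArg rot h
  simpa only [map_mul, map_add, rot_rot_rot] using this

lemma IsSolution.rot_rot_eq (h : IsSolution F G l χ) :
    rot (rot l) * χ = rot F * rot χ + G * rot (rot χ) := by
  have := congrArg rot h.rot_eq
  simpa only [map_mul, map_add, rot_rot_rot] using this

lemma IsSolution.expand_mul (h : IsSolution F G l χ) (N : ℂ[X]) :
    IsSolution F G l (expand ℂ 3 N * χ) := by
  unfold IsSolution at *
  simp only [map_mul, rot_expand]
  linear_combination expand ℂ 3 N * h

lemma IsSolution.sub {χ' : ℂ[X]} (h : IsSolution F G l χ) (h' : IsSolution F G l χ') :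
    IsSolution F G l (χ - χ') := by
  unfold IsSolution at *
  simp only [map_sub]
  linear_combination h - h'

/-- The Casoratian of two solutions vanishes. -/
lemma IsSolution.casoratian {q : ℂ[X]} (hχ : IsSolution F G l χ) (hq : IsSolution F G l q)
    (hgap : gap F G ≠ 0) : rot q * χ = q * rot χ := by
  have e1 := hχ.rot_eq
  have e2 := hχ.rot_rot_eq
  have d1 := hq.rot_eq
  have d2 := hq.rot_rot_eq
  unfold IsSolution at hχ hq
  -- Eliminating l, W = `rot q * χ - q * rot χ` satisfies `rot (rot F) * rot W = rot G * W`. Going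
  -- once around the orbit gives `gap F G * W = 0`.
  have h0 : gap F G * (rot q * χ - q * rot χ) = 0 := by
    unfold gap
    linear_combination F * rot (rot F) * (e2 * q - d2 * χ)
      + rot (rot F) * G * (e1 * rot (rot q) - d1 * rot (rot χ))
      + G * rot (rot G) * (hχ * rot q - hq * rot χ)
  exact sub_eq_zero.mp ((mul_eq_zero.mp h0).resolve_left hgap)

/-- A solution whose degree is not much larger than the minimal one is a multiple of the
solution of minimal degree. -/
lemma IsSolution.eq_C_mul_of_minimal (hχ : IsSolution F G l χ) (hχ0 : χ ≠ 0)
    (hmin : ∀ q, IsSolution F G l q → q ≠ 0 → χ.natDegree ≤ q.natDegree)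
    (hgap : gap F G ≠ 0) {q : ℂ[X]} (hq : IsSolution F G l q)
    (hdeg : q.natDegree < χ.natDegree + 3) : ∃ c, q = C c * χ := by
  -- The top coefficients of the Casoratian identity give ω^deg p = ω^deg χ, so the degrees agree
  -- modulo 3; minimality and the window of width 3 force equality.
  have key : ∀ p : ℂ[X], IsSolution F G l p → p ≠ 0 →
      p.natDegree < χ.natDegree + 3 → p.natDegree = χ.natDegree := by
    intro p hp hp0 hpd
    have h1 := hχ.casoratian hp hgap
    have h2 := congrArg (fun P => P.coeff (p.natDegree + χ.natDegree)) h1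
    have e1 : (rot p * χ).coeff (p.natDegree + χ.natDegree) =
        p.leadingCoeff * ω ^ p.natDegree * χ.leadingCoeff := by
      conv_lhs => rw [← natDegree_rot p]
      rw [coeff_mul_degree_add_degree, leadingCoeff, natDegree_rot, coeff_rot,
        coeff_natDegree]
    have e2 : (p * rot χ).coeff (p.natDegree + χ.natDegree) =
        p.leadingCoeff * (χ.leadingCoeff * ω ^ χ.natDegree) := by
      conv_lhs => rw [← natDegree_rot χ]
      rw [coeff_mul_degree_add_degree, leadingCoeff, leadingCoeff, natDegree_rot, coeff_rot,
        leadingCoeff]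
    simp only [e1, e2] at h2
    have h3 : ω ^ p.natDegree = ω ^ χ.natDegree := by
      have ha := leadingCoeff_ne_zero.mpr hp0
      have hb := leadingCoeff_ne_zero.mpr hχ0
      apply mul_left_cancel₀ (mul_ne_zero ha hb)
      linear_combination h2
    have h4 := hmin p hp hp0
    have h5 : 3 ∣ p.natDegree - χ.natDegree := by
      rw [← ω_isPrimitiveRoot.pow_eq_one_iff_dvd]
      apply mul_left_cancel₀ (pow_ne_zero χ.natDegree ω_ne_zero)
      rw [← pow_add, Nat.add_sub_cancel' h4, h3, mul_one]
    omega
  by_cases hq0 : q = 0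
  · exact ⟨0, by simp [hq0]⟩
  have hqd := key q hq hq0 hdeg
  refine ⟨q.leadingCoeff / χ.leadingCoeff, ?_⟩
  by_contra hne
  set c := q.leadingCoeff / χ.leadingCoeff with hc
  -- Cancelling the leading term produces a solution of degree below the minimum.
  have hs : IsSolution F G l (q - C c * χ) := by
    have := hχ.expand_mul (C c)
    rw [expand_C] at this
    exact hq.sub this
  have hs0 : q - C c * χ ≠ 0 := sub_ne_zero.mpr hne
  have hc0 : c ≠ 0 := div_ne_zero (leadingCoeff_ne_zero.mpr hq0) (leadingCoeff_ne_zero.mpr hχ0)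
  have hlt : (q - C c * χ).degree < q.degree := by
    refine degree_sub_lt_left ?_ hq0 ?_
    · rw [degree_C_mul hc0, degree_eq_natDegree hq0, degree_eq_natDegree hχ0, hqd]
    · rw [leadingCoeff_mul, leadingCoeff_C, hc, div_mul_cancel₀ _ (leadingCoeff_ne_zero.mpr hχ0)]
  have := natDegree_lt_natDegree hs0 hlt
  have := hmin _ hs hs0
  omega

/-- The determinant condition for the existence of a solution, in terms of the fused eigenvalue. -/
lemma IsSolution.fused_identity (h : IsSolution F G l χ) (h0 : χ ≠ 0) :
    fused F G l * rot (fused F G l) * rot (rot (fused F G l))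
      - fused F G l * rot (fused F G l) * (F * rot F)
      - fused F G l * rot (rot (fused F G l)) * (F * rot (rot F))
      - rot (fused F G l) * rot (rot (fused F G l)) * (rot F * rot (rot F))
      + gap F G * (F * fused F G l + rot F * rot (fused F G l)
        + rot (rot F) * rot (rot (fused F G l))) = gap F G ^ 2 := by
  have e1 := h.rot_eq
  have e2 := h.rot_rot_eq
  unfold IsSolution at h
  -- The cyclic system has the nonzero solution χ, so its determinant vanishes. Multiplying by the
  -- orbit product of G and writing G l as b - `rot F * rot (rot F)` gives the claim.
  have hdet : l * rot l * rot (rot l) - l * F * G - rot l * rot F * rot G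
      - rot (rot l) * rot (rot F) * rot (rot G)
      - F * rot F * rot (rot F) - G * rot G * rot (rot G) = 0 := by
    have : (l * rot l * rot (rot l) - l * F * G - rot l * rot F * rot G
      - rot (rot l) * rot (rot F) * rot (rot G)
      - F * rot F * rot (rot F) - G * rot G * rot (rot G)) * χ = 0 := by
      linear_combination (rot (rot G) * G + rot l * rot F) * h
        + (l * G + rot F * rot (rot F)) * e1 + (l * rot l - rot (rot F) * rot (rot G)) * e2
    exact (mul_eq_zero.mp this).resolve_right h0
  simp only [fused, gap, map_add, map_mul, rot_rot_rot]
  linear_combination G * rot G * rot (rot G) * hdet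

/-- For real coefficients, a solution and its conjugate have a Wronskian that is invariant under
the rotation, and the fused eigenvalue factorises over the solution and its conjugate. -/
lemma IsSolution.exists_factorization (h : IsSolution F G l χ) (h0 : χ ≠ 0)
    (hF : conjPoly F = F) (hG : conjPoly G = G) (hl : conjPoly l = l) (hgap : gap F G ≠ 0) :
    ∃ n m : ℂ[X], IsCoprime n m ∧ n ≠ 0 ∧
      expand ℂ 3 n * (χ * conjPoly χ) = expand ℂ 3 m * fused F G l := by
  have e1 := h.rot_eq
  have e2 := h.rot_rot_eq
  set ψ := conjPoly χ with hψ
  -- The conjugate equation runs around the orbit in the opposite direction.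
  have hc : l * rot (rot ψ) = rot F * rot ψ + rot (rot G) * ψ := by
    have := congrArg conjPoly h
    simpa only [map_mul, map_add, conjPoly_rot, rot_rot_rot, hF, hG, hl] using this
  unfold IsSolution at h
  -- H is the Wronskian of χ and its conjugate; eliminating l between their two equations shows that
  -- it is invariant.
  set H := F * χ * ψ - G * rot (rot χ) * rot ψ with hH
  have hH2 : rot (rot H) = rot H := by
    simp only [hH, map_sub, map_mul, rot_rot_rot]
    linear_combination hc * rot χ - h * rot (rot ψ)
  have hHrot : rot H = H := by
    have := congrArg rot hH2
    rw [rot_rot_rot] at this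
    rw [hH2] at this
    exact this.symm
  have hgaprot : rot (gap F G) = gap F G := by
    simp only [gap, map_sub, map_mul, rot_rot_rot]
    ring
  obtain ⟨k, hk⟩ := exists_expand_of_rot_eq_self hgaprot
  obtain ⟨K, hK⟩ := exists_expand_of_rot_eq_self hHrot
  have hmain : gap F G * (χ * ψ) = H * fused F G l := by
    have a1 : rot F * rot χ * rot ψ - rot G * χ * rot (rot ψ) = H := by
      rw [← hHrot]
      simp only [hH, map_sub, map_mul, rot_rot_rot]
    have a2 : rot (rot F) * rot (rot χ) * rot (rot ψ) - rot (rot G) * rot χ * ψ = H := by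
      rw [← hHrot, ← hH2]
      simp only [hH, map_sub, map_mul, rot_rot_rot]
    -- The three rotated expressions for H combine with the equation for χ only after multiplication
    -- by the nonzero `rot χ * rot (rot χ)`.
    have : (gap F G * (χ * ψ) - H * fused F G l) * (rot χ * rot (rot χ)) = 0 := by
      simp only [gap, fused]
      linear_combination (rot F * rot (rot F) * rot χ * rot (rot χ)) * (-hH)
        + G * rot (rot F) * rot (rot χ) ^ 2 * a1
        + G * rot G * rot (rot χ) * χ * a2 - H * G * rot (rot χ) * h
    have hne := mul_ne_zero (rot_ne_zero h0) (rot_ne_zero (rot_ne_zero h0))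
    exact sub_eq_zero.mp ((mul_eq_zero.mp this).resolve_right hne)
  have hk0 : k ≠ 0 := by
    rintro rfl
    exact hgap (by simpa using hk)
  have hg0 : EuclideanDomain.gcd k K ≠ 0 := fun h => hk0 (EuclideanDomain.gcd_eq_zero_iff.mp h).1
  obtain ⟨n, hn⟩ := EuclideanDomain.gcd_dvd_left k K
  obtain ⟨m, hm⟩ := EuclideanDomain.gcd_dvd_right k K
  refine ⟨n, m, ?_, ?_, ?_⟩
  · have := EuclideanDomain.gcd_eq_gcd_ab k K
    refine ⟨EuclideanDomain.gcdA k K, EuclideanDomain.gcdB k K, ?_⟩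
    apply mul_left_cancel₀ hg0
    linear_combination (-EuclideanDomain.gcdA k K) * hn - EuclideanDomain.gcdB k K * hm - this
  · rintro rfl
    exact hk0 (by rw [hn, mul_zero])
  · have hg : expand ℂ 3 (EuclideanDomain.gcd k K) ≠ 0 := by
      rwa [Ne, expand_eq_zero (by norm_num)]
    apply mul_left_cancel₀ hg
    have e := hmain
    rw [hk, hK] at e
    have hn' := congrArg (expand ℂ 3) hn
    have hm' := congrArg (expand ℂ 3) hm
    rw [map_mul] at hn' hm'
    linear_combination e - χ * ψ * hn' + fused F G l * hm'

end DifferenceEquation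

/-! ### Degree bounds for the coefficients of the TQ relation. -/

section Coefficients
open Polynomial

/-- The coefficient `F` of the difference equation. -/
def coeffF (ε M : ℕ) : ℂ[X] := (1 - X ^ 2) ^ ε * (1 + X) ^ M

/-- The coefficient `G` of the difference equation. -/
def coeffG (ε M : ℕ) (δ : ℂ) : ℂ[X] := C δ * (1 - X ^ 2) ^ ε * (1 - X) ^ M

/-- The gap as a polynomial in the third power of the variable. -/
def cubicGap (ε M : ℕ) (δ : ℂ) : ℂ[X] := (1 - X ^ 2) ^ ε * ((1 + X) ^ M - C δ * (1 - X) ^ M)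

variable {ε M : ℕ} {δ : ℂ}

/-- Over an orbit the factors 1 ± X multiply to 1 ± X³, so both orbit products are F and G with X³
substituted; δ survives because δ³ = δ. -/
lemma gap_coeff (hδ : δ ^ 2 = 1) :
    gap (coeffF ε M) (coeffG ε M δ) = expand ℂ 3 (cubicGap ε M δ) := by
  have hC2 : (C ω : ℂ[X]) ^ 2 + C ω + 1 = 0 := by
    rw [← C_pow, ← C_add, ← C_1, ← C_add, ω_sq_add, C_0]
  have hC3 : (C ω : ℂ[X]) ^ 3 = 1 := by rw [← C_pow, ω_pow_three, C_1]
  have hδ3 : (C δ : ℂ[X]) ^ 3 = C δ := by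
    rw [← C_pow]
    congr 1
    linear_combination δ * hδ
  have h1 : (1 + X : ℂ[X]) * (1 + C ω * X) * (1 + C ω * (C ω * X)) = 1 + X ^ 3 := by
    linear_combination (X + C ω * X ^ 2) * hC2 + X ^ 3 * hC3
  have h2 : (1 - X : ℂ[X]) * (1 - C ω * X) * (1 - C ω * (C ω * X)) = 1 - X ^ 3 := by
    linear_combination (-X + C ω * X ^ 2) * hC2 - X ^ 3 * hC3
  have h3 : (1 - X ^ 2 : ℂ[X]) * (1 - (C ω * X) ^ 2) * (1 - (C ω * (C ω * X)) ^ 2)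
      = 1 - (X ^ 3) ^ 2 := by
    calc _ = ((1 + X : ℂ[X]) * (1 + C ω * X) * (1 + C ω * (C ω * X)))
          * ((1 - X : ℂ[X]) * (1 - C ω * X) * (1 - C ω * (C ω * X))) := by ring
      _ = _ := by rw [h1, h2]; ring
  simp only [gap, coeffF, coeffG, cubicGap, map_mul, map_sub, map_add, map_pow, map_one, rot_X,
    rot_C, expand_X, expand_C]
  rw [← h3, ← h1, ← h2]
  simp only [mul_pow]
  linear_combination (-(1 - X ^ 2) ^ ε * (1 - C ω ^ 2 * X ^ 2) ^ ε *
    (1 - C ω ^ 2 * (C ω ^ 2 * X ^ 2)) ^ ε * (1 - X) ^ M * (1 - C ω * X) ^ M *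
    (1 - C ω * (C ω * X)) ^ M) * hδ3

lemma conjPoly_coeffF : conjPoly (coeffF ε M) = coeffF ε M := by
  simp [coeffF, conjPoly]

lemma conjPoly_coeffG (hδ : starRingEnd ℂ δ = δ) :
    conjPoly (coeffG ε M δ) = coeffG ε M δ := by
  simp [coeffG, conjPoly, hδ]

lemma one_sub_X_sq_ne_zero : (1 - X ^ 2 : ℂ[X]) ≠ 0 := by
  intro h
  have := congrArg (fun P => P.coeff 0) h
  simp at this

lemma natDegree_one_sub_X_sq : (1 - X ^ 2 : ℂ[X]).natDegree = 2 := by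
  compute_degree!

lemma natDegree_coeffF_le : (coeffF ε M).natDegree ≤ M + 2 * ε := by
  unfold coeffF
  compute_degree
  omega

lemma coeff_one_sub_X_pow (n k : ℕ) :
    ((1 - X : ℂ[X]) ^ n).coeff k = (n.choose k : ℂ) * (-1) ^ k := by
  have : (1 - X : ℂ[X]) ^ n = ((1 + X) ^ n).comp (C (-1) * X) := by
    simp [sub_eq_add_neg]
  rw [this, comp_C_mul_X_coeff, coeff_one_add_X_pow]

/-- The coefficient of X^j in the difference of powers is binomial(M, j)(1 - δ(-1)^j). It cannot
vanish for both j = M and j = M - 1, so at most one degree is lost. -/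
lemma cubicGap_degree (hδ : δ = 1 ∨ δ = -1) (hM : M ≠ 0) :
    cubicGap ε M δ ≠ 0 ∧ M + 2 * ε ≤ (cubicGap ε M δ).natDegree + 1 := by
  obtain ⟨k, rfl⟩ := Nat.exists_eq_succ_of_ne_zero hM
  set P : ℂ[X] := (1 + X) ^ (k + 1) - C δ * (1 - X) ^ (k + 1) with hP
  have hc : ∀ j, P.coeff j = ((k + 1).choose j : ℂ) * (1 - δ * (-1) ^ j) := fun j => by
    rw [hP, coeff_sub, coeff_C_mul, coeff_one_sub_X_pow, coeff_one_add_X_pow]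
    ring
  have hk : (k : ℂ) + 1 ≠ 0 := by exact_mod_cast Nat.succ_ne_zero k
  have hex : P.coeff (k + 1) ≠ 0 ∨ P.coeff k ≠ 0 := by
    rw [hc, hc]
    rcases hδ with rfl | rfl <;> rcases neg_one_pow_eq_or ℂ k with h | h <;>
      simp [pow_succ, h] <;> exact hk
  have hP0 : P ≠ 0 := by
    rintro h
    simp [h] at hex
  have hPd : k ≤ P.natDegree := by
    rcases hex with h | h
    · exact (Nat.le_succ k).trans (le_natDegree_of_ne_zero h)
    · exact le_natDegree_of_ne_zero h
  have hs := pow_ne_zero ε one_sub_X_sq_ne_zero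
  refine ⟨mul_ne_zero hs hP0, ?_⟩
  have : (cubicGap ε (k + 1) δ).natDegree = ε * 2 + P.natDegree := by
    rw [cubicGap, natDegree_mul hs hP0, natDegree_pow, natDegree_one_sub_X_sq]
  simp only [Nat.succ_eq_add_one]
  omega

lemma coeff_zero_cubicGap : (cubicGap ε M δ).coeff 0 = 1 - δ := by
  simp [cubicGap, coeff_zero_eq_eval_zero]

lemma coeff_one_cubicGap : (cubicGap ε M 1).coeff 1 = 2 * M := by
  have h : (cubicGap ε M 1).derivative.eval 0 = (cubicGap ε M 1).coeff 1 := by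
    rw [← coeff_zero_eq_eval_zero, coeff_derivative]
    simp
  rw [← h]
  simp [cubicGap, derivative_mul, derivative_pow]
  ring

/-- The fused eigenvalue does not vanish on a full orbit of the rotation. -/
lemma IsSolution.not_fused_orbit {l χ : ℂ[X]} (h : IsSolution (coeffF ε M) (coeffG ε M δ) l χ)
    (h0 : χ ≠ 0) (hδ : δ = 1 ∨ δ = -1) (hM : M ≠ 0) {Γ : Type*}
    [LinearOrderedCommGroupWithZero Γ] (v : Valuation ℂ Γ) (h2 : v 2 < 1)
    (hint : ∀ a, v a ≤ 1 → v (l.eval a) ≤ 1) {a : ℂ} (ha0 : a ≠ 0)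
    (ha : ∀ k : ℕ, (fused (coeffF ε M) (coeffG ε M δ) l).eval (ω ^ k * a) = 0) : False := by
  have hδ2 : δ ^ 2 = 1 := by rcases hδ with rfl | rfl <;> norm_num
  -- With b zero at all three points, only `gap` squared survives in the determinant identity.
  have hgap0 : (cubicGap ε M δ).eval (a ^ 3) = 0 := by
    have h1 := congrArg (fun P => P.eval a) (h.fused_identity h0)
    have b0 := ha 0
    have b1 := ha 1
    have b2 := ha 2
    rw [pow_zero, one_mul] at b0
    rw [pow_one] at b1
    rw [pow_two, mul_assoc] at b2
    simp only [eval_add, eval_sub, eval_mul, eval_pow, eval_rot, b0, b1, b2, gap_coeff hδ2,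
      expand_eval] at h1
    exact pow_eq_zero_iff (two_ne_zero) |>.mp (by linear_combination -h1)
  -- If a³ is congruent to 1, some orbit point c is congruent to 1 and b(c) is a unit. Otherwise the
  -- vanishing gap forces a³ = 0.
  by_cases hy : v (a ^ 3 - 1) < 1
  · obtain ⟨k, hk⟩ := exists_valuation_ω_pow_mul_sub_one_lt v hy
    set c := ω ^ k * a with hc
    have hvc : v c = 1 := valuation_eq_one_of_sub_lt v (map_one v) hk
    have hω := valuation_ω v
    have hl := hint c hvc.le
    have e := ha k
    rw [← hc] at e
    -- Since c is congruent to 1, the factors of F(ωc) F(ω²c) reduce to those at ω and ω²: here 1 +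
    -- ω = -ω².
    have u1 : v (1 + ω * c) = 1 := by
      refine valuation_eq_one_of_sub_lt v (x := -ω ^ 2)
        (by rw [Valuation.map_neg, map_pow, hω, one_pow]) ?_
      have : 1 + ω * c - -ω ^ 2 = ω * (c - 1) := by linear_combination ω_sq_add
      rw [this, map_mul, hω, one_mul]
      exact hk
    have u2 : v (1 + ω * (ω * c)) = 1 := by
      refine valuation_eq_one_of_sub_lt v (x := -ω) (by rw [Valuation.map_neg, hω]) ?_
      have : 1 + ω * (ω * c) - -ω = ω ^ 2 * (c - 1) := by linear_combination ω_sq_add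
      rw [this, map_mul, map_pow, hω, one_pow, one_mul]
      exact hk
    -- 3 = (1 - ω)(1 - ω²) is odd, hence a unit, and so are both factors.
    have v3 : v 3 = 1 := by
      refine valuation_eq_one_of_sub_lt v (map_one v) ?_
      norm_num
      exact h2
    have v12 : ∀ x y : ℂ, v x ≤ 1 → v y ≤ 1 → v (x * y) = 1 → v x = 1 := by
      intro x y hx hy hxy
      rw [map_mul] at hxy
      refine le_antisymm hx ?_
      rw [← hxy]
      exact mul_le_of_le_one_right' hy
    have hω1 : v (1 - ω ^ 2) = 1 := by
      have := v3
      rw [show (3 : ℂ) = (1 - ω ^ 2) * (1 - ω) by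
        linear_combination ω_sq_add - ω_pow_three] at this
      refine v12 _ _ (v.map_sub_le (by simp) (by simp [hω]))
        (v.map_sub_le (by simp) (by simp [hω])) this
    have hω2 : v (1 - ω) = 1 := by
      have := v3
      rw [show (3 : ℂ) = (1 - ω) * (1 - ω ^ 2) by
        linear_combination ω_sq_add - ω_pow_three] at this
      refine v12 _ _ (v.map_sub_le (by simp) (by simp [hω]))
        (v.map_sub_le (by simp) (by simp [hω])) this
    have hc2 : v (c ^ 2 - 1) < 1 := by
      rw [show c ^ 2 - 1 = (c - 1) * (c + 1) by ring, map_mul]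
      exact mul_lt_one_of_lt_of_le hk (v.map_add_le hvc.le (by simp))
    have w1 : v (1 - (ω * c) ^ 2) = 1 := by
      refine valuation_eq_one_of_sub_lt v hω1 ?_
      rw [show 1 - (ω * c) ^ 2 - (1 - ω ^ 2) = -(ω ^ 2) * (c ^ 2 - 1) by ring, map_mul,
        Valuation.map_neg, map_pow, hω, one_pow, one_mul]
      exact hc2
    have w2 : v (1 - (ω * (ω * c)) ^ 2) = 1 := by
      refine valuation_eq_one_of_sub_lt v hω2 ?_
      rw [show 1 - (ω * (ω * c)) ^ 2 - (1 - ω) = -ω * (c ^ 2 - 1) by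
        linear_combination - ω * c ^ 2 * ω_pow_three, map_mul,
        Valuation.map_neg, hω, one_mul]
      exact hc2
    simp only [fused, eval_add, eval_mul, eval_rot, coeffF, coeffG, eval_sub, eval_pow, eval_X,
      eval_one, eval_C] at e
    -- F(ωc) F(ω²c) is a unit, whereas G(c) l(c) contains (1 - c)^M with M > 0 and l(c) is integral;
    -- the two cannot cancel.
    have e1 := congrArg v (eq_neg_of_add_eq_zero_left e)
    simp only [Valuation.map_neg, map_mul, map_pow, u1, u2, w1, w2, one_pow, mul_one] at e1
    have hδv : v δ = 1 := by rcases hδ with rfl | rfl <;> simp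
    have hs : v (1 - c ^ 2) ≤ 1 := by
      rw [← Valuation.map_neg, neg_sub]
      exact hc2.le
    have hc1 : v (1 - c) ^ M < 1 := by
      rw [← Valuation.map_neg, neg_sub]
      exact pow_lt_one₀ zero_le hk hM
    have : v δ * v (1 - c ^ 2) ^ ε * v (1 - c) ^ M * v (l.eval c) < 1 := by
      rw [hδv, one_mul]
      rw [mul_comm (_ ^ ε)]
      exact mul_lt_one_of_lt_of_le (mul_lt_one_of_lt_of_le hc1 (pow_le_one₀ zero_le hs)) hl
    exact absurd e1.symm this.ne
  · rw [not_lt] at hy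
    have hy1 : a ^ 3 ≠ 1 := by
      intro h
      rw [h] at hy
      simp at hy
    have hy2 : a ^ 3 ≠ -1 := by
      intro h
      rw [h, show (-1 - 1 : ℂ) = - 2 by norm_num, Valuation.map_neg] at hy
      exact absurd h2 (not_lt.mpr hy)
    simp only [cubicGap, eval_mul, eval_sub, eval_pow, eval_add, eval_one, eval_X, eval_C] at hgap0
    have hs : (1 - (a ^ 3) ^ 2) ^ ε ≠ 0 := by
      apply pow_ne_zero
      rw [show 1 - (a ^ 3) ^ 2 = -((a ^ 3 - 1) * (a ^ 3 - -1)) by ring]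
      exact neg_ne_zero.mpr (mul_ne_zero (sub_ne_zero.mpr hy1) (sub_ne_zero.mpr hy2))
    have h3 := (mul_eq_zero.mp hgap0).resolve_left hs
    -- Squaring removes δ and makes the exponent even.
    have h4 : (1 + a ^ 3) ^ (2 * M) = (1 - a ^ 3) ^ (2 * M) := by
      rw [mul_comm, pow_mul, pow_mul, sub_eq_zero.mp h3, mul_pow, hδ2, one_mul]
    have := eq_zero_of_one_add_pow_eq_one_sub_pow v h2 (by omega) hy h4 (even_two_mul M)
    exact ha0 (pow_eq_zero_iff (by norm_num) |>.mp this)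

/-- The fused eigenvalue does not vanish to third order at the origin. -/
lemma IsSolution.not_X_pow_dvd_fused {l χ : ℂ[X]}
    (h : IsSolution (coeffF ε M) (coeffG ε M δ) l χ)
    (h0 : χ ≠ 0) (hδ : δ = 1 ∨ δ = -1) (hM : M ≠ 0) (hl : conjPoly l = l) :
    ¬ X ^ 3 ∣ fused (coeffF ε M) (coeffG ε M δ) l := by
  rintro ⟨c, hc⟩
  have hδ2 : δ ^ 2 = 1 := by rcases hδ with rfl | rfl <;> norm_num
  have hid := h.fused_identity h0
  have hC3 : (C ω : ℂ[X]) ^ 3 = 1 := by rw [← C_pow, ω_pow_three, C_1]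
  have r1 : rot (fused (coeffF ε M) (coeffG ε M δ) l) = X ^ 3 * rot c := by
    rw [hc, map_mul, map_pow, rot_X, mul_pow, hC3, one_mul]
  have r2 : rot (rot (fused (coeffF ε M) (coeffG ε M δ) l)) = X ^ 3 * rot (rot c) := by
    rw [r1, map_mul, map_pow, rot_X, mul_pow, hC3, one_mul]
  rw [r2, r1, hc, gap_coeff hδ2] at hid
  rcases hδ with rfl | rfl
  -- For δ = 1 the gap is X³ times a polynomial with value 2M at 0, so X⁶ can be divided out of the
  -- determinant identity.
  · have hX : X ∣ cubicGap ε M 1 := by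
      rw [X_dvd_iff, coeff_zero_cubicGap, sub_self]
    obtain ⟨d, hd⟩ := hX
    have hd0 : d.eval 0 = 2 * M := by
      rw [← coeff_one_cubicGap (ε := ε), hd, coeff_X_mul, coeff_zero_eq_eval_zero]
    rw [hd, map_mul, expand_X] at hid
    have hid' : X ^ 3 * c * rot c * rot (rot c)
        - c * rot c * (coeffF ε M * rot (coeffF ε M))
        - c * rot (rot c) * (coeffF ε M * rot (rot (coeffF ε M)))
        - rot c * rot (rot c) * (rot (coeffF ε M) * rot (rot (coeffF ε M)))
        + expand ℂ 3 d * (coeffF ε M * c + rot (coeffF ε M) * rot c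
          + rot (rot (coeffF ε M)) * rot (rot c)) = expand ℂ 3 d ^ 2 := by
      apply mul_left_cancel₀ (pow_ne_zero 6 (X_ne_zero (R := ℂ)))
      linear_combination hid
    have he := congrArg (fun P => P.eval 0) hid'
    have hF0 : (coeffF ε M).eval 0 = 1 := by simp [coeffF]
    simp only [eval_add, eval_sub, eval_mul, eval_pow, eval_rot, expand_eval, eval_X, mul_zero,
      zero_pow three_ne_zero, hF0, hd0] at he
    have hreal : starRingEnd ℂ (c.eval 0) = c.eval 0 := by
      have h1 : conjPoly (fused (coeffF ε M) (coeffG ε M 1) l) =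
          fused (coeffF ε M) (coeffG ε M 1) l := by
        simp only [fused, map_add, map_mul, conjPoly_rot, conjPoly_coeffF, hl,
          conjPoly_coeffG (map_one _), rot_rot_rot]
        ring
      have h2 := congrArg (fun P => P.coeff 3) h1
      simp only [coeff_conjPoly, hc] at h2
      have h3 : (X ^ 3 * c).coeff 3 = c.eval 0 := by
        have := coeff_X_pow_mul c 3 0
        rwa [zero_add, coeff_zero_eq_eval_zero] at this
      rwa [h3] at h2
    obtain ⟨r, hr⟩ := Complex.conj_eq_iff_real.mp hreal
    rw [hr] at he
    -- At 0 this is 3(r - M)² + M² = 0 with r real, impossible for M > 0.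
    have he' : -3 * r ^ 2 + 3 * (2 * (M : ℝ)) * r = (2 * (M : ℝ)) ^ 2 := by
      have : (((-3 * r ^ 2 + 3 * (2 * (M : ℝ)) * r : ℝ)) : ℂ) = (((2 * (M : ℝ)) ^ 2 : ℝ) : ℂ) := by
        push_cast
        linear_combination he
      exact_mod_cast this
    have hMpos : (0 : ℝ) < M := by exact_mod_cast Nat.pos_of_ne_zero hM
    nlinarith [sq_nonneg (r - M)]
  -- For δ = -1 the gap equals 2 at 0, and the identity reads 0 = 4 there.
  · have he := congrArg (fun P => P.eval 0) hid
    simp only [eval_add, eval_sub, eval_mul, eval_pow, expand_eval, eval_X, mul_zero,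
      zero_pow three_ne_zero, zero_mul, ← coeff_zero_eq_eval_zero, coeff_zero_cubicGap] at he
    norm_num at he

/-- The degree of the fused eigenvalue. -/
lemma IsSolution.le_natDegree_fused {l χ : ℂ[X]}
    (h : IsSolution (coeffF ε M) (coeffG ε M δ) l χ)
    (h0 : χ ≠ 0) (hδ : δ = 1 ∨ δ = -1) (hM : M ≠ 0) :
    2 * M + 4 * ε ≤ (fused (coeffF ε M) (coeffG ε M δ) l).natDegree + 5 := by
  by_contra! hlt
  have hδ2 : δ ^ 2 = 1 := by rcases hδ with rfl | rfl <;> norm_num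
  have hid := h.fused_identity h0
  obtain ⟨hg0, hg⟩ := cubicGap_degree (ε := ε) hδ hM
  set F := coeffF ε M
  set b := fused F (coeffG ε M δ) l
  rw [gap_coeff hδ2] at hid
  set g := expand ℂ 3 (cubicGap ε M δ) with hgdef
  have hgd : g.natDegree = 3 * (cubicGap ε M δ).natDegree := by
    rw [hgdef, natDegree_expand, mul_comm]
  have hF : F.natDegree ≤ M + 2 * ε := natDegree_coeffF_le
  have hdeg := congrArg natDegree hid
  rw [natDegree_pow] at hdeg
  have bound : ∀ P Q : ℂ[X], ∀ p q : ℕ, P.natDegree ≤ p → Q.natDegree ≤ q →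
      (P * Q).natDegree ≤ p + q := fun P Q p q hp hq => natDegree_mul_le_of_le hp hq
  have hr : ∀ (P : ℂ[X]) (p : ℕ), P.natDegree ≤ p → (rot P).natDegree ≤ p := fun P p hp => by
    rwa [natDegree_rot]
  have hb : b.natDegree ≤ b.natDegree := le_rfl
  have hb1 := hr _ _ hb
  have hb2 := hr _ _ hb1
  have hF1 := hr _ _ hF
  have hF2 := hr _ _ hF1
  -- With S = M + 2ε and deg g ≥ 3S - 3, all terms on the left of the determinant identity have
  -- degree below that of g² as soon as deg b ≤ 2S - 6.
  have hle : 2 * g.natDegree ≤ max (max (3 * b.natDegree) (2 * b.natDegree + 2 * (M + 2 * ε)))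
      (g.natDegree + (M + 2 * ε) + b.natDegree) := by
    rw [← hdeg]
    refine (natDegree_add_le _ _).trans (max_le_max ?_ ?_)
    · refine (natDegree_sub_le_of_le (natDegree_sub_le_of_le (natDegree_sub_le_of_le
        (bound _ _ _ _ (bound _ _ _ _ hb hb1) hb2) (bound _ _ _ _ (bound _ _ _ _ hb hb1)
        (bound _ _ _ _ hF hF1))) (bound _ _ _ _ (bound _ _ _ _ hb hb2)
        (bound _ _ _ _ hF hF2))) (bound _ _ _ _ (bound _ _ _ _ hb1 hb2)
        (bound _ _ _ _ hF1 hF2))).trans ?_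
      omega
    · refine (bound _ _ _ _ le_rfl (natDegree_add_le_of_degree_le (natDegree_add_le_of_degree_le
        (bound _ _ _ _ hF hb) (bound _ _ _ _ hF1 hb1)) (bound _ _ _ _ hF2 hb2))).trans ?_
      omega
  omega

/-- Solutions have a large degree. -/
lemma IsSolution.le_natDegree {l χ : ℂ[X]}
    (h : IsSolution (coeffF ε M) (coeffG ε M δ) l χ)
    (h0 : χ ≠ 0) (hδ : δ = 1 ∨ δ = -1) (hM : M ≠ 0) (hl : conjPoly l = l) {Γ : Type*}
    [LinearOrderedCommGroupWithZero Γ] (v : Valuation ℂ Γ) (h2 : v 2 < 1)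
    (hint : ∀ a, v a ≤ 1 → v (l.eval a) ≤ 1) :
    M + 2 * ε ≤ χ.natDegree + 2 := by
  have hδ2 : δ ^ 2 = 1 := by rcases hδ with rfl | rfl <;> norm_num
  have hδr : starRingEnd ℂ δ = δ := by rcases hδ with rfl | rfl <;> simp
  obtain ⟨hg0, -⟩ := cubicGap_degree (ε := ε) hδ hM
  have hgap : gap (coeffF ε M) (coeffG ε M δ) ≠ 0 := by
    rwa [gap_coeff hδ2, Ne, expand_eq_zero (by norm_num)]
  obtain ⟨n, m, hnm, hn0, hfac⟩ := h.exists_factorization h0 conjPoly_coeffF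
    (conjPoly_coeffG hδr) hl hgap
  set b := fused (coeffF ε M) (coeffG ε M δ) l with hb
  -- At a root y = a³ of n coprimality gives m(y) ≠ 0, so the fused eigenvalue absorbs the whole
  -- zero: on the full orbit of a, or to third order when a = 0.
  have hroot : ∀ y, ¬ n.IsRoot y := by
    intro y hy
    have hmy : m.eval y ≠ 0 := by
      intro hm
      obtain ⟨A, B, hAB⟩ := hnm
      have := congrArg (fun P => P.eval y) hAB
      simp [hm, hy.eq_zero] at this
    obtain ⟨a, rfl⟩ := IsAlgClosed.exists_pow_nat_eq y (n := 3) (by norm_num)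
    by_cases ha : a = 0
    · subst ha
      refine h.not_X_pow_dvd_fused h0 hδ hM hl ?_
      rw [zero_pow three_ne_zero] at hy hmy
      obtain ⟨n', hn'⟩ : X ∣ n := by rwa [X_dvd_iff, coeff_zero_eq_eval_zero]
      have hcop : IsCoprime (X ^ 3 : ℂ[X]) (expand ℂ 3 m) := by
        have hX : IsCoprime (X : ℂ[X]) m := by
          rw [irreducible_X.coprime_iff_not_dvd, X_dvd_iff, coeff_zero_eq_eval_zero]
          exact hmy
        have := hX.map (expand ℂ 3 : ℂ[X] →ₐ[ℂ] ℂ[X]).toRingHom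
        simpa using this
      refine hcop.dvd_of_dvd_mul_left ⟨expand ℂ 3 n' * (χ * conjPoly χ), ?_⟩
      rw [← hb, ← hfac, hn', map_mul, expand_X]
      ring
    · refine h.not_fused_orbit h0 hδ hM v h2 hint ha fun k => ?_
      have h3 : (ω ^ k * a) ^ 3 = a ^ 3 := by
        rw [mul_pow, ← pow_mul, mul_comm k, pow_mul, ω_pow_three, one_pow, one_mul]
      have := congrArg (fun P => P.eval (ω ^ k * a)) hfac
      simp only [eval_mul, expand_eval, h3, hy.eq_zero, zero_mul] at this
      exact (mul_eq_zero.mp this.symm).resolve_left hmy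
  have hndeg : n.natDegree = 0 := by
    by_contra hd
    obtain ⟨y, hy⟩ := IsAlgClosed.exists_root n (by
      intro h
      exact hd (natDegree_eq_of_degree_eq_some h))
    exact hroot y hy
  have hm0 : m ≠ 0 ∧ b ≠ 0 := by
    have hne : expand ℂ 3 n * (χ * conjPoly χ) ≠ 0 :=
      mul_ne_zero (by rwa [Ne, expand_eq_zero (by norm_num)]) (mul_ne_zero h0 (conjPoly_ne_zero h0))
    rw [hfac] at hne
    refine ⟨?_, right_ne_zero_of_mul hne⟩
    rintro rfl
    simp at hne
  -- With n constant, 2 deg χ = 3 deg m + deg b ≥ 2(M + 2ε) - 5, and parity improves the bound on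
  -- deg χ to M + 2ε - 2.
  have hd := congrArg natDegree hfac
  rw [natDegree_mul (by rwa [Ne, expand_eq_zero (by norm_num)])
      (mul_ne_zero h0 (conjPoly_ne_zero h0)), natDegree_mul h0 (conjPoly_ne_zero h0),
    natDegree_conjPoly, natDegree_expand, hndeg,
    natDegree_mul (by rw [Ne, expand_eq_zero (by norm_num)]; exact hm0.1) hm0.2] at hd
  have := h.le_natDegree_fused h0 hδ hM
  rw [← hb] at this
  omega

end Coefficients

/-! ### Transfer matrices as traces of nested products. -/

section Chain

variable {A B : Type} [Fintype A] [DecidableEq A] [Fintype B] [DecidableEq B]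

/-- The matrix element of an operator between two states of a site, as an operator on the
auxiliary space. -/
def blk (M : Matrix (A × ZMod 3) (A × ZMod 3) ℂ) (s t : ZMod 3) : Matrix A A ℂ :=
  Matrix.of fun a b => M (a, s) (b, t)

/-- The matrix elements of `M_{0n} ⋯ M_{01} N_{01} ⋯ N_{0n}`, as operators on the auxiliary
space. -/
def chain (M N : Matrix (A × ZMod 3) (A × ZMod 3) ℂ) :
    (n : ℕ) → Config n → Config n → Matrix A A ℂ
  | 0, _, _ => 1
  | n + 1, s, u => ∑ t, blk M (s (Fin.last n)) t *
      chain M N n (fun i => s i.castSucc) (fun i => u i.castSucc) * blk N t (u (Fin.last n))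

/-- The matrix elements of a product over a list of sites followed by the product over the
reversed list. -/
def sandwich {n : ℕ} (M N : Matrix (A × ZMod 3) (A × ZMod 3) ℂ) (l : List (Fin n))
    (s u : Config n) : Matrix A A ℂ :=
  l.foldr (fun k X => ∑ t, blk M (s k) t * X * blk N t (u k)) 1

lemma sandwich_cons {n : ℕ} (M N : Matrix (A × ZMod 3) (A × ZMod 3) ℂ) (k : Fin n)
    (l : List (Fin n)) (s u : Config n) :
    sandwich M N (k :: l) s u = ∑ t, blk M (s k) t * sandwich M N l s u * blk N t (u k) :=
  rfl

lemma sandwich_congr {n : ℕ} (M N : Matrix (A × ZMod 3) (A × ZMod 3) ℂ) {l : List (Fin n)}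
    {s u s' u' : Config n} (hs : ∀ k ∈ l, s k = s' k) (hu : ∀ k ∈ l, u k = u' k) :
    sandwich M N l s u = sandwich M N l s' u' := by
  induction l with
  | nil => rfl
  | cons k l ih =>
    have := ih (fun j hj => hs j (List.mem_cons_of_mem _ hj))
      (fun j hj => hu j (List.mem_cons_of_mem _ hj))
    simp only [sandwich, List.foldr_cons] at this ⊢
    rw [this, hs k List.mem_cons_self, hu k List.mem_cons_self]

omit [DecidableEq A] [Fintype A] in
lemma sum_agree {n : ℕ} (k : Fin n) (s : Config n) (f : Config n → ℂ) :
    ∑ p : Config n, (if ∀ l, l ≠ k → s l = p l then f p else 0) =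
      ∑ t, f (Function.update s k t) := by
  rw [← Finset.sum_filter]
  symm
  refine Finset.sum_bij (fun t _ => Function.update s k t) ?_ ?_ ?_ ?_
  · intro t _
    simp only [Finset.mem_filter, Finset.mem_univ, true_and]
    intro l hl
    rw [Function.update_of_ne hl]
  · intro t _ t' _ h
    exact Function.update_injective s k h
  · intro p hp
    refine ⟨p k, Finset.mem_univ _, ?_⟩
    funext l
    by_cases hl : l = k
    · subst hl; simp
    · rw [Function.update_of_ne hl]
      exact (Finset.mem_filter.mp hp).2 l hl
  · intro t _
    rfl

omit [DecidableEq A] in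
lemma onSite_mul_apply {n : ℕ} (M : Matrix (A × ZMod 3) (A × ZMod 3) ℂ) (k : Fin n)
    (Y : Matrix (A × Config n) (A × Config n) ℂ) (a : A) (s : Config n) (x : A × Config n) :
    (onSite M k * Y) (a, s) x =
      ∑ t, ∑ b, M (a, s k) (b, t) * Y (b, Function.update s k t) x := by
  rw [mul_apply, Fintype.sum_prod_type, Finset.sum_comm]
  have h := sum_agree k s fun p => ∑ b, M (a, s k) (b, p k) * Y (b, p) x
  simp only [Function.update_self] at h
  rw [← h]
  refine Finset.sum_congr rfl fun p _ => ?_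
  simp only [onSite, of_apply, ite_mul, zero_mul]
  split_ifs <;> simp

omit [DecidableEq A] in
lemma mul_onSite_apply {n : ℕ} (N : Matrix (A × ZMod 3) (A × ZMod 3) ℂ) (k : Fin n)
    (Y : Matrix (A × Config n) (A × Config n) ℂ) (d : A) (u : Config n) (x : A × Config n) :
    (Y * onSite N k) x (d, u) =
      ∑ t, ∑ c, Y x (c, Function.update u k t) * N (c, t) (d, u k) := by
  rw [mul_apply, Fintype.sum_prod_type, Finset.sum_comm]
  have h := sum_agree k u fun p => ∑ c, Y x (c, p) * N (c, p k) (d, u k)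
  simp only [Function.update_self] at h
  rw [← h]
  refine Finset.sum_congr rfl fun p _ => ?_
  simp only [onSite, of_apply, mul_ite, mul_zero, eq_comm (a := p _)]
  split_ifs <;> simp

/-- The first site of l carries the leftmost M and the rightmost N, so the auxiliary matrices nest
around the remaining sites. Each site contributes one summed intermediate state, and sites outside l
stay unchanged. -/
lemma prod_onSite_apply {n : ℕ} (M N : Matrix (A × ZMod 3) (A × ZMod 3) ℂ) (l : List (Fin n))
    (hl : l.Nodup) (a d : A) (s u : Config n) :
    ((l.map (onSite M)).prod * (l.reverse.map (onSite N)).prod) (a, s) (d, u) =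
      if ∀ k, k ∉ l → s k = u k then sandwich M N l s u a d else 0 := by
  induction l generalizing a d s u with
  | nil =>
    simp only [List.map_nil, List.prod_nil, List.reverse_nil, mul_one, one_apply, Prod.mk.injEq,
      sandwich, List.foldr_nil, List.not_mem_nil, not_false_eq_true, forall_true_left]
    by_cases h : s = u
    · subst h; simp
    · have h' : ¬ ∀ k, s k = u k := fun h0 => h (funext h0)
      simp [h, h']
  | cons k l ih =>
    obtain ⟨hk, hl⟩ := List.nodup_cons.mp hl
    have hprod : ((k :: l).map (onSite M)).prod * ((k :: l).reverse.map (onSite N)).prod =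
        onSite M k *
          (((l.map (onSite M)).prod * (l.reverse.map (onSite N)).prod) * onSite N k) := by
      simp [mul_assoc]
    rw [hprod, onSite_mul_apply]
    simp only [mul_onSite_apply, ih hl]
    have hcond : ∀ t t', (∀ j, j ∉ l → Function.update s k t j = Function.update u k t' j) ↔
        (t = t' ∧ ∀ j, j ∉ k :: l → s j = u j) := by
      intro t t'
      constructor
      · intro h
        refine ⟨by simpa using h k hk, fun j hj => ?_⟩
        have hjk : j ≠ k := fun h0 => hj (h0 ▸ List.mem_cons_self)
        have := h j fun h0 => hj (List.mem_cons_of_mem _ h0)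
        rwa [Function.update_of_ne hjk, Function.update_of_ne hjk] at this
      · rintro ⟨rfl, h⟩ j hj
        by_cases hjk : j = k
        · subst hjk; simp
        · rw [Function.update_of_ne hjk, Function.update_of_ne hjk]
          exact h j (by simp [hjk, hj])
    have hsw : ∀ t t', sandwich M N l (Function.update s k t) (Function.update u k t') =
        sandwich M N l s u := fun t t' => by
      refine sandwich_congr M N ?_ ?_ <;>
      · intro j hj
        rw [Function.update_of_ne]
        rintro rfl
        exact hk hj
    simp only [hcond, hsw]
    by_cases h : ∀ j, j ∉ k :: l → s j = u j
    · rw [if_pos h]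
      have hin : ∀ t b, ∑ t', ∑ c, (if t = t' then sandwich M N l s u b c else 0) *
          N (c, t') (d, u k) = ∑ c, sandwich M N l s u b c * N (c, t) (d, u k) := by
        intro t b
        rw [Finset.sum_comm]
        simp [ite_mul]
      have hand : ∀ t t' : ZMod 3, (t = t' ∧ ∀ j, j ∉ k :: l → s j = u j) ↔ t = t' :=
        fun t t' => and_iff_left h
      simp only [hand, hin]
      rw [sandwich_cons, Matrix.sum_apply]
      refine Finset.sum_congr rfl fun t _ => ?_
      rw [mul_assoc, mul_apply]
      refine Finset.sum_congr rfl fun b _ => ?_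
      rw [mul_apply]
      rfl
    · have hand : ∀ t t' : ZMod 3, (t = t' ∧ ∀ j, j ∉ k :: l → s j = u j) ↔ False :=
        fun t t' => iff_false_intro fun h' => h h'.2
      rw [if_neg h]
      simp only [hand, if_false, zero_mul, mul_zero, Finset.sum_const_zero]

/-- This replaces operators on the whole chain by the recursion `chain`, whose outermost layer is
the last site; the inductions on the length use this form. -/
lemma traceAux_prodDown_mul_prodUp {n : ℕ} (M N : Matrix (A × ZMod 3) (A × ZMod 3) ℂ)
    (s u : Config n) :
    traceAux (prodDown n M * prodUp n N) s u = (chain M N n s u).trace := by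
  have h1 : prodUp n N = ((List.finRange n).reverse.reverse.map (onSite N)).prod := by
    rw [List.reverse_reverse, prodUp]
  have h2 : ∀ (n : ℕ) (s u : Config n),
      sandwich M N (List.finRange n).reverse s u = chain M N n s u := by
    intro n
    induction n with
    | zero => intro s u; simp [sandwich, chain]
    | succ n ih =>
      intro s u
      simp only [chain, ← ih]
      rw [sandwich, List.finRange_succ_last, List.reverse_append, ← List.map_reverse]
      simp only [List.reverse_cons, List.reverse_nil, List.nil_append, List.cons_append,
        List.foldr_cons, List.foldr_map]
      rfl
  rw [h1, prodDown, traceAux, of_apply, trace]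
  refine Finset.sum_congr rfl fun a _ => ?_
  rw [prod_onSite_apply M N _ (List.nodup_reverse.mpr (List.nodup_finRange n)), if_pos (by simp),
    h2,
    diag_apply]


omit [Fintype A] in
lemma onSite_one {n : ℕ} (k : Fin n) :
    onSite (1 : Matrix (A × ZMod 3) (A × ZMod 3) ℂ) k = 1 := by
  ext ⟨a, s⟩ ⟨b, u⟩
  simp only [onSite, of_apply, one_apply, Prod.mk.injEq]
  by_cases h : ∀ l, l ≠ k → s l = u l
  · rw [if_pos h]
    congr 1
    refine propext (and_congr_right fun _ => ⟨fun hk => ?_, fun hs => by rw [hs]⟩)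
    funext l
    by_cases hl : l = k
    · rw [hl, hk]
    · exact h l hl
  · rw [if_neg h, if_neg]
    rintro ⟨-, rfl⟩
    exact h fun _ _ => rfl

/-- A single row is thereby a double row with trivial second half, so the periodic case needs no
separate theory. -/
lemma prodUp_one {n : ℕ} : prodUp n (1 : Matrix (A × ZMod 3) (A × ZMod 3) ℂ) = 1 := by
  rw [prodUp]
  exact List.prod_eq_one fun x hx => by
    obtain ⟨k, -, rfl⟩ := List.mem_map.mp hx
    exact onSite_one k

end Chain

/-! ### Abstract fusion of two double rows. -/

section Fusion

variable {A B C : Type} [Fintype A] [DecidableEq A] [Fintype B] [DecidableEq B]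
  [Fintype C] [DecidableEq C]

/-- The product of the matrix elements of two chains, as an operator on the product of the two
auxiliary spaces. -/
def chainPair (L L' : Matrix (A × ZMod 3) (A × ZMod 3) ℂ)
    (R R' : Matrix (B × ZMod 3) (B × ZMod 3) ℂ) (n : ℕ) (s u : Config n) :
    Matrix (A × B) (A × B) ℂ :=
  ∑ p, chain L L' n s p ⊗ₖ chain R R' n p u

lemma trace_chainPair (L L' : Matrix (A × ZMod 3) (A × ZMod 3) ℂ)
    (R R' : Matrix (B × ZMod 3) (B × ZMod 3) ℂ) (n : ℕ) (s u : Config n) :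
    (chainPair L L' R R' n s u).trace =
      (traceAux (prodDown n L * prodUp n L') * traceAux (prodDown n R * prodUp n R')) s u := by
  rw [chainPair, trace_sum, mul_apply]
  refine Finset.sum_congr rfl fun p _ => ?_
  rw [trace_kronecker, traceAux_prodDown_mul_prodUp, traceAux_prodDown_mul_prodUp]

lemma sum_kronecker {ι κ m n m' n' : Type*} (s : Finset ι) (t : Finset κ)
    (f : ι → Matrix m n ℂ) (g : κ → Matrix m' n' ℂ) :
    (∑ i ∈ s, f i) ⊗ₖ (∑ j ∈ t, g j) = ∑ i ∈ s, ∑ j ∈ t, f i ⊗ₖ g j := by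
  ext ⟨a, b⟩ ⟨c, d⟩
  simp only [kroneckerMap_apply, Matrix.sum_apply, Finset.sum_mul_sum]

/-- At the last site the order is L, L', R, R'. The state x between L' and R joins the two chains,
and R has to be moved past L' before L and R can be fused. -/
lemma chainPair_succ (L L' : Matrix (A × ZMod 3) (A × ZMod 3) ℂ)
    (R R' : Matrix (B × ZMod 3) (B × ZMod 3) ℂ) (n : ℕ) (s u : Config (n + 1)) :
    chainPair L L' R R' (n + 1) s u = ∑ t, ∑ t', ∑ x,
      (blk L (s (Fin.last n)) t ⊗ₖ blk R x t') *
        chainPair L L' R R' n (fun i => s i.castSucc) (fun i => u i.castSucc) *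
          (blk L' t x ⊗ₖ blk R' t' (u (Fin.last n))) := by
  have h1 : chainPair L L' R R' (n + 1) s u = ∑ x, ∑ p : Config n, ∑ t, ∑ t',
      (blk L (s (Fin.last n)) t ⊗ₖ blk R x t') *
        (chain L L' n (fun i => s i.castSucc) p ⊗ₖ chain R R' n p (fun i => u i.castSucc)) *
          (blk L' t x ⊗ₖ blk R' t' (u (Fin.last n))) := by
    rw [chainPair, ← (Fin.snocEquiv fun _ : Fin (n + 1) => ZMod 3).sum_comp, Fintype.sum_prod_type]
    refine Finset.sum_congr rfl fun x _ => Finset.sum_congr rfl fun p _ => ?_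
    simp only [Fin.snocEquiv_apply, chain, Fin.snoc_last, Fin.snoc_castSucc, sum_kronecker,
      mul_kronecker_mul]
  rw [h1, Finset.sum_comm]
  simp only [chainPair, Finset.mul_sum, Finset.sum_mul]
  rw [Finset.sum_comm]
  have h2 : ∀ f : ZMod 3 → Config n → ZMod 3 → ZMod 3 → Matrix (A × B) (A × B) ℂ,
      ∑ x, ∑ p, ∑ t, ∑ t', f x p t t' = ∑ t, ∑ t', ∑ x, ∑ p, f x p t t' := fun f => by
    rw [Finset.sum_congr rfl fun x _ => Finset.sum_comm, Finset.sum_comm]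
    refine Finset.sum_congr rfl fun t _ => ?_
    rw [Finset.sum_congr rfl fun x _ => Finset.sum_comm, Finset.sum_comm]
  exact h2 _

/-- The operator product of two local operators in the site, as an operator on both auxiliary
spaces. -/
def fuse (L : Matrix (A × ZMod 3) (A × ZMod 3) ℂ) (R : Matrix (B × ZMod 3) (B × ZMod 3) ℂ)
    (s u : ZMod 3) : Matrix (A × B) (A × B) ℂ :=
  ∑ t, blk L s t ⊗ₖ blk R t u

/-- `Θ` exchanges the order in which `L'` and `R` act. -/
def Exchanges (Θ : Matrix (A × B) (A × B) ℂ →ₗ[ℂ] Matrix (A × B) (A × B) ℂ)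
    (L' : Matrix (A × ZMod 3) (A × ZMod 3) ℂ) (R : Matrix (B × ZMod 3) (B × ZMod 3) ℂ) : Prop :=
  ∀ (M : Matrix A A ℂ) (N : Matrix B B ℂ) (X : Matrix (A × B) (A × B) ℂ) (t t' : ZMod 3),
    ∑ x, Θ ((M ⊗ₖ blk R x t') * X * (blk L' t x ⊗ₖ N)) =
      ∑ x, (M ⊗ₖ blk R t x) * Θ X * (blk L' x t' ⊗ₖ N)

variable {L L' : Matrix (A × ZMod 3) (A × ZMod 3) ℂ} {R R' : Matrix (B × ZMod 3) (B × ZMod 3) ℂ}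
  {Θ : Matrix (A × B) (A × B) ℂ →ₗ[ℂ] Matrix (A × B) (A × B) ℂ}

/-- After Θ, the last site reads L R on the left and L' R' on the right, so the recursion is again
nested, now in fused operators. -/
lemma exchange_chainPair_succ (hΘ : Exchanges Θ L' R) (n : ℕ) (s u : Config (n + 1)) :
    Θ (chainPair L L' R R' (n + 1) s u) = ∑ x, fuse L R (s (Fin.last n)) x *
      Θ (chainPair L L' R R' n (fun i => s i.castSucc) (fun i => u i.castSucc)) *
        fuse L' R' x (u (Fin.last n)) := by
  rw [chainPair_succ]
  simp only [map_sum]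
  have h : ∀ t t', ∑ x, Θ ((blk L (s (Fin.last n)) t ⊗ₖ blk R x t') *
      chainPair L L' R R' n (fun i => s i.castSucc) (fun i => u i.castSucc) *
        (blk L' t x ⊗ₖ blk R' t' (u (Fin.last n)))) = _ := fun t t' => hΘ _ _ _ t t'
  simp only [h, fuse, Finset.sum_mul, Finset.mul_sum]
  rw [Finset.sum_congr rfl fun t _ => Finset.sum_comm, Finset.sum_comm]
  refine Finset.sum_congr rfl fun x _ => ?_
  rw [Finset.sum_comm]

/-- Q passes the outer left factor, becomes Q' across the inner chain by induction, and then passes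
the outer right factor; κ is picked up once, at the empty chain. -/
lemma left_intertwine (hΘ : Exchanges Θ L' R) {Rf Rf' : Matrix (C × ZMod 3) (C × ZMod 3) ℂ}
    {Q Q' : Matrix C (A × B) ℂ} {cf cf' κ : ℂ}
    (hQ : ∀ s u, Q * fuse L R s u = cf • (blk Rf s u * Q))
    (hQ' : ∀ s u, Q' * fuse L' R' s u = cf' • (blk Rf' s u * Q')) (h0 : Q * Θ 1 = κ • Q')
    (n : ℕ) (s u : Config n) :
    Q * Θ (chainPair L L' R R' n s u) = (κ * (cf * cf') ^ n) • (chain Rf Rf' n s u * Q') := by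
  induction n with
  | zero =>
    have : chainPair L L' R R' 0 s u = 1 := by
      simp [chainPair, chain]
    rw [this, h0, chain, pow_zero, mul_one, Matrix.one_mul]
  | succ n ih =>
    rw [exchange_chainPair_succ hΘ, Matrix.mul_sum, chain, Matrix.sum_mul, Finset.smul_sum]
    refine Finset.sum_congr rfl fun x _ => ?_
    rw [Matrix.mul_assoc (fuse L R _ _), ← Matrix.mul_assoc Q, hQ, Matrix.smul_mul,
      Matrix.mul_assoc (blk Rf _ _), ← Matrix.mul_assoc Q, ih, Matrix.smul_mul,
      Matrix.mul_assoc (chain Rf Rf' n _ _), hQ']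
    simp only [Matrix.mul_smul, smul_smul, Matrix.mul_assoc]
    congr 1
    ring

/-- The mirror image: J' enters from the right and emerges as J. -/
lemma right_intertwine (hΘ : Exchanges Θ L' R) {Rg Rg' : Matrix (C × ZMod 3) (C × ZMod 3) ℂ}
    {J J' : Matrix (A × B) C ℂ} {cg cg' κ : ℂ}
    (hJ : ∀ s u, fuse L R s u * J = cg • (J * blk Rg s u))
    (hJ' : ∀ s u, fuse L' R' s u * J' = cg' • (J' * blk Rg' s u)) (h0 : Θ 1 * J' = κ • J)
    (n : ℕ) (s u : Config n) :
    Θ (chainPair L L' R R' n s u) * J' = (κ * (cg * cg') ^ n) • (J * chain Rg Rg' n s u) := by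
  induction n with
  | zero =>
    have : chainPair L L' R R' 0 s u = 1 := by
      simp [chainPair, chain]
    rw [this, h0, chain, pow_zero, mul_one, Matrix.mul_one]
  | succ n ih =>
    rw [exchange_chainPair_succ hΘ, Matrix.sum_mul, chain, Matrix.mul_sum, Finset.smul_sum]
    refine Finset.sum_congr rfl fun x _ => ?_
    rw [Matrix.mul_assoc, hJ', Matrix.mul_smul, Matrix.mul_assoc, ← Matrix.mul_assoc (Θ _) J', ih,
      Matrix.smul_mul, Matrix.mul_smul, ← Matrix.mul_assoc (fuse L R _ _),
      ← Matrix.mul_assoc (fuse L R _ _), hJ]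
    simp only [Matrix.smul_mul, smul_smul, Matrix.mul_assoc]
    congr 1
    ring

/-- Fusion of two transfer matrices, given that the product of their auxiliary spaces has an
invariant subspace `J` with quotient `Q` on either side of the chain. -/
theorem fusion {Rf Rf' Rg Rg' : Matrix (C × ZMod 3) (C × ZMod 3) ℂ}
    {Q Q' P₂ : Matrix C (A × B) ℂ} {J J' P₁ : Matrix (A × B) C ℂ} {K : Matrix (A × B) (A × B) ℂ}
    {cf cf' cg cg' κf κg α β d : ℂ} (hΘ : Exchanges Θ L' R)
    (hQ : ∀ s u, Q * fuse L R s u = cf • (blk Rf s u * Q))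
    (hQ' : ∀ s u, Q' * fuse L' R' s u = cf' • (blk Rf' s u * Q'))
    (hJ : ∀ s u, fuse L R s u * J = cg • (J * blk Rg s u))
    (hJ' : ∀ s u, fuse L' R' s u * J' = cg' • (J' * blk Rg' s u))
    (hQ0 : Q * Θ 1 = κf • Q') (hJ0 : Θ 1 * J' = κg • J)
    (hK : ∀ X, d * X.trace = (K * Θ X).trace) (hQK : Q' * K = α • Q) (hKJ : K * J = β • J')
    (h1 : P₁ * Q + J * P₂ = 1) (hP₁ : Q * P₁ = 1) (hP₂ : P₂ * J = 1) (n : ℕ) :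
    d • (traceAux (prodDown n L * prodUp n L') * traceAux (prodDown n R * prodUp n R')) =
      (α * κf * (cf * cf') ^ n) • traceAux (prodDown n Rf * prodUp n Rf') +
        (β * κg * (cg * cg') ^ n) • traceAux (prodDown n Rg * prodUp n Rg') := by
  ext s u
  have hU := left_intertwine hΘ hQ hQ' hQ0 n s u
  have hW := right_intertwine hΘ hJ hJ' hJ0 n s u
  rw [Matrix.add_apply, Matrix.smul_apply, Matrix.smul_apply, Matrix.smul_apply,
    traceAux_prodDown_mul_prodUp Rf, traceAux_prodDown_mul_prodUp Rg, ← trace_chainPair,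
    smul_eq_mul,
    hK]
  set Y := Θ (chainPair L L' R R' n s u)
  -- Splitting the identity as P₁Q + JP₂ separates quotient and subspace; cyclicity of the trace
  -- then brings Q next to Y in one term and J' behind Y in the other.
  have e : K * Y = K * P₁ * (Q * Y) + β • (J' * (P₂ * Y)) := by
    rw [← Matrix.smul_mul, ← hKJ]
    calc K * Y = K * ((P₁ * Q + J * P₂) * Y) := by rw [h1, one_mul]
      _ = _ := by simp only [Matrix.add_mul, Matrix.mul_add, Matrix.mul_assoc]
  rw [e, trace_add, trace_smul, trace_mul_comm J', Matrix.mul_assoc P₂, hW, hU, Matrix.mul_smul,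
    Matrix.mul_smul, trace_smul, trace_smul, ← Matrix.mul_assoc P₂, hP₂, Matrix.one_mul,
    ← Matrix.mul_assoc, trace_mul_comm, Matrix.mul_assoc K, ← Matrix.mul_assoc Q', hQK,
    Matrix.smul_mul, ← Matrix.mul_assoc, hP₁, Matrix.one_mul, trace_smul]
  simp only [smul_eq_mul]
  ring

end Fusion

/-! ### Entries of the local operators. -/

lemma forall_zmod_three {p : ZMod 3 → Prop} : (∀ i, p i) ↔ p 0 ∧ p 1 ∧ p 2 :=
  ⟨fun h => ⟨h 0, h 1, h 2⟩, fun ⟨h0, h1, h2⟩ i => by fin_cases i <;> assumption⟩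

lemma sum_zmod_three {M : Type*} [AddCommMonoid M] (f : ZMod 3 → M) :
    ∑ i, f i = f 0 + f 1 + f 2 :=
  Fin.sum_univ_three f

lemma zmod_three_table : ((0 : ZMod 3) - 1 = 2) ∧ ((0 : ZMod 3) - 2 = 1) ∧ ((1 : ZMod 3) - 2 = 2) ∧
    ((2 : ZMod 3) - 1 = 1) ∧ ((1 : ZMod 3) + 1 = 2) ∧ ((1 : ZMod 3) + 2 = 0) ∧
    ((2 : ZMod 3) + 1 = 0) ∧ ((2 : ZMod 3) + 2 = 1) ∧ (-(1 : ZMod 3) = 2) ∧ (-(2 : ZMod 3) = 1) ∧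
    ((2 : ZMod 3) * 2 = 1) ∧ ((0 : ZMod 3) ≠ 1) ∧ ((0 : ZMod 3) ≠ 2) ∧ ((1 : ZMod 3) ≠ 2) ∧
    ((1 : ZMod 3) ≠ 0) ∧ ((2 : ZMod 3) ≠ 0) ∧ ((2 : ZMod 3) ≠ 1) := by
  decide

lemma ωpow_zero : ωpow 0 = 1 := pow_zero _

lemma ωpow_one : ωpow 1 = ω := pow_one _

lemma ωpow_two : ωpow 2 = ω ^ 2 := rfl

/-- The matrix element of `Lop` between two states. -/
lemma Lop_apply (z : ℂ) (a b : Fin 2) (s t : ZMod 3) :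
    Lop z (a, s) (b, t) = if a = b then (if s = (if a = 0 then t - 1 else t + 1) then z else 0)
      else (if s = t then ωpow (if a = 0 then 1 - s else s - 1) else 0) := by
  have h : ∀ a b : Fin 2, ∀ s t : ZMod 3, Lop z (a, s) (b, t) =
      if a = b then (if s = (if a = 0 then t - 1 else t + 1) then z else 0)
      else (if s = t then ωpow (if a = 0 then 1 - s else s - 1) else 0) := by
    simp only [Fin.forall_fin_two, forall_zmod_three, Lop, sum_zmod_three, e2, e3,
      Matrix.add_apply, Matrix.smul_apply, kroneckerMap_apply, single_apply, zmod_three_table,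
      smul_eq_mul]
    simp [zmod_three_table]
  exact h a b s t

lemma Lbar_apply (z : ℂ) (a b : Fin 2) (s t : ZMod 3) :
    Lbar z (a, s) (b, t) = if a = b then (if s = (if a = 0 then t + 1 else t - 1) then 1 else 0)
      else (if s = t then z * ωpow (if a = 0 then 1 - s else s - 1) else 0) := by
  have h : ∀ a b : Fin 2, ∀ s t : ZMod 3, Lbar z (a, s) (b, t) =
      if a = b then (if s = (if a = 0 then t + 1 else t - 1) then 1 else 0)
      else (if s = t then z * ωpow (if a = 0 then 1 - s else s - 1) else 0) := by
    simp only [Fin.forall_fin_two, forall_zmod_three, Lbar, sum_zmod_three, e2, e3,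
      Matrix.add_apply, Matrix.smul_apply, kroneckerMap_apply, single_apply, zmod_three_table,
      smul_eq_mul]
    simp [zmod_three_table]
  exact h a b s t

/-- The coefficients of the `R`-matrix. -/
def rcoef (z₁ z₂ : ℂ) (a j : ZMod 3) : ℂ :=
  -(1 / 3) * ∑ b : ZMod 3, ωpow (2 * a * (b + j)) * wt₁ z₁ b * wt₂ z₂ (b - j)

/-- The four indices determine i = s, a = α - s, j = β - s, so at most one summand contributes; the
remaining index condition is β + α = t + s. -/
lemma Rmat_apply (z₁ z₂ : ℂ) (α β s t : ZMod 3) :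
    Rmat z₁ z₂ (β, t) (α, s) = if β + α = t + s then rcoef z₁ z₂ (α - s) (β - s) else 0 := by
  have h : ∀ c : ZMod 3 → ZMod 3 → ℂ, ∀ β t α s : ZMod 3, (∑ a : ZMod 3, ∑ i : ZMod 3, ∑ j : ZMod 3,
      c a j • (e3 (i + j) (i + a) ⊗ₖ e3 (i + a + j) i)) (β, t) (α, s) =
        if β + α = t + s then c (α - s) (β - s) else 0 := by
    intro c
    simp only [forall_zmod_three, sum_zmod_three, e3, Matrix.add_apply, Matrix.smul_apply,
      kroneckerMap_apply, single_apply, zmod_three_table, smul_eq_mul, add_zero, zero_add]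
    simp
  exact h (rcoef z₁ z₂) _ _ _ _

lemma rcoef_table (z₁ z₂ : ℂ) :
    rcoef z₁ z₂ 0 0 = 1 + ((ω - 1) * z₁ - (2 + ω) * z₂) / 3 + z₁ * z₂ ∧
    rcoef z₁ z₂ 0 1 = (1 + 2 * ω) * (z₂ - z₁) / 3 ∧
    rcoef z₁ z₂ 0 2 = (1 + 2 * ω) * (z₂ - z₁) / 3 ∧
    rcoef z₁ z₂ 1 0 = ((2 + ω) * z₁ + (1 - ω) * z₂) / 3 ∧
    rcoef z₁ z₂ 1 1 = ((ω - 1) * z₁ - (2 + ω) * z₂) / 3 + z₁ * z₂ ∧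
    rcoef z₁ z₂ 1 2 = 1 + ((ω - 1) * z₁ - (2 + ω) * z₂) / 3 ∧
    rcoef z₁ z₂ 2 0 = ((2 + ω) * z₁ + (1 - ω) * z₂) / 3 ∧
    rcoef z₁ z₂ 2 1 = 1 + ((ω - 1) * z₁ - (2 + ω) * z₂) / 3 ∧
    rcoef z₁ z₂ 2 2 = ((ω - 1) * z₁ - (2 + ω) * z₂) / 3 + z₁ * z₂ := by
  have hω := ω_sq_add
  simp only [rcoef, sum_zmod_three, wt₁, wt₂, zmod_three_table, mul_zero,
    zero_mul, ωpow_zero, ωpow_one, ωpow_two, if_true, if_false, sub_zero, zero_add, add_zero,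
    mul_one, one_mul, sub_self]
  refine ⟨?_, ?_, ?_, ?_, ?_, ?_, ?_, ?_, ?_⟩ <;> grind

lemma fuse_apply {A B : Type} (L : Matrix (A × ZMod 3) (A × ZMod 3) ℂ)
    (R : Matrix (B × ZMod 3) (B × ZMod 3) ℂ) (s u : ZMod 3) (p q : A × B) :
    fuse L R s u p q = ∑ t, L (p.1, s) (q.1, t) * R (p.2, t) (q.2, u) := by
  simp only [fuse, Matrix.sum_apply]
  rfl

lemma blk_apply {A : Type} (M : Matrix (A × ZMod 3) (A × ZMod 3) ℂ) (s t : ZMod 3) (a b : A) :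
    blk M s t a b = M (a, s) (b, t) := rfl

/-! ### The local fusion relations. -/

/-- The projection onto the quotient for the product `L R`. -/
def quotL : Matrix (ZMod 3) (Fin 2 × ZMod 3) ℂ := Matrix.of fun b p =>
  if p.1 = 0 then (if b = p.2 + 1 then ωpow (2 + 2 * p.2) else 0)
  else (if b = p.2 - 1 then ωpow p.2 else 0)

/-- The inclusion of the invariant subspace for the product `L R`. -/
def inclL : Matrix (Fin 2 × ZMod 3) (ZMod 3) ℂ := Matrix.of fun p g =>
  if p.1 = 0 then (if g = p.2 + 1 then -ωpow p.2 else 0)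
  else (if g = p.2 - 1 then ωpow (2 + 2 * p.2) else 0)

/-- A section of `quotL`. -/
def sectL : Matrix (Fin 2 × ZMod 3) (ZMod 3) ℂ := Matrix.of fun p b =>
  if p.1 = 0 then (if b = p.2 + 1 then ωpow (1 + p.2) / 2 else 0)
  else (if b = p.2 - 1 then ωpow (2 * p.2) / 2 else 0)

/-- A retraction of `inclL`. -/
def retrL : Matrix (ZMod 3) (Fin 2 × ZMod 3) ℂ := Matrix.of fun g p =>
  if p.1 = 0 then (if g = p.2 + 1 then -ωpow (2 * p.2) / 2 else 0)
  else (if g = p.2 - 1 then ωpow (1 + p.2) / 2 else 0)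

/-- The projection onto the quotient for the second half of a double row. -/
def quotR : Matrix (ZMod 3) (Fin 2 × ZMod 3) ℂ := Matrix.of fun b p =>
  if p.1 = 0 then (if b = p.2 - 1 then ωpow (1 + 2 * p.2) else 0)
  else (if b = p.2 + 1 then ωpow (2 + p.2) else 0)

/-- The inclusion of the invariant subspace for the second half of a double row. -/
def inclR : Matrix (Fin 2 × ZMod 3) (ZMod 3) ℂ := Matrix.of fun p g =>
  if p.1 = 0 then (if g = p.2 - 1 then -ωpow p.2 else 0)
  else (if g = p.2 + 1 then ωpow (2 + 2 * p.2) else 0)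

/-- The quotient half of the block-triangular form of L(z)R(ωz); the scalar is the source of the
power of 1 + ω²z in f. The proof is an entrywise check modulo ω² + ω + 1 = 0. -/
lemma quotL_mul_fuse (z z₂ : ℂ) (s u : ZMod 3) : quotL * fuse (Lop z) (Rmat (ω * z) z₂) s u =
    (1 + ω ^ 2 * z) • (blk (Rmat (ω ^ 2 * z) z₂) s u * quotL) := by
  have h : ∀ b : ZMod 3, ∀ a : Fin 2, ∀ c s u : ZMod 3,
      (quotL * fuse (Lop z) (Rmat (ω * z) z₂) s u) b (a, c) =
        (1 + ω ^ 2 * z) * (blk (Rmat (ω ^ 2 * z) z₂) s u * quotL) b (a, c) := by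
    simp only [Fin.forall_fin_two, forall_zmod_three, quotL,
      mul_apply, fuse_apply, blk_apply, Fintype.sum_prod_type, Fin.sum_univ_two, sum_zmod_three,
      of_apply, Lop_apply, Rmat_apply, zmod_three_table, if_true, if_false, zero_mul, mul_zero,
      add_zero, zero_add, sub_zero, sub_self, zero_ne_one, one_ne_zero, mul_one, one_mul,
      ωpow_zero, ωpow_one, ωpow_two]
    have hω := ω_sq_add
    simp only [rcoef_table, true_and, and_true]
    repeat' apply And.intro
    all_goals grind
  ext b ⟨a, c⟩
  exact h _ _ _ _ _

/-- The invariant-subspace half; the scalar is the source of the power of ωz - 1 in g. -/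
lemma fuse_mul_inclL (z z₂ : ℂ) (s u : ZMod 3) : fuse (Lop z) (Rmat (ω * z) z₂) s u * inclL =
    (ω * z - 1) • (inclL * blk (Rmat z z₂) s u) := by
  have h : ∀ b : ZMod 3, ∀ a : Fin 2, ∀ c s u : ZMod 3,
      (fuse (Lop z) (Rmat (ω * z) z₂) s u * inclL) (a, c) b =
        (ω * z - 1) * (inclL * blk (Rmat z z₂) s u) (a, c) b := by
    simp only [Fin.forall_fin_two, forall_zmod_three, inclL,
      mul_apply, fuse_apply, blk_apply, Fintype.sum_prod_type, Fin.sum_univ_two, sum_zmod_three,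
      of_apply, Lop_apply, Rmat_apply, zmod_three_table, if_true, if_false, zero_mul, mul_zero,
      add_zero, zero_add, sub_zero, sub_self, zero_ne_one, one_ne_zero, mul_one, one_mul,
      ωpow_zero, ωpow_one, ωpow_two]
    have hω := ω_sq_add
    simp only [rcoef_table, true_and, and_true]
    repeat' apply And.intro
    all_goals grind
  ext ⟨a, c⟩ b
  exact h _ _ _ _ _

/-- In the open case the second half acts with the tensor factors of R exchanged, so its quotient
and subspace differ from those of the first half, while the scalars agree up to sign. -/
lemma quotR_mul_fuse (z z₂ : ℂ) (s u : ZMod 3) :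
    quotR * fuse (Lbar z) ((Rmat (ω * z) z₂).submatrix Prod.swap Prod.swap) s u =
      (1 + ω ^ 2 * z) •
        (blk ((Rmat (ω ^ 2 * z) z₂).submatrix Prod.swap Prod.swap) s u * quotR) := by
  have h : ∀ b : ZMod 3, ∀ a : Fin 2, ∀ c s u : ZMod 3,
      (quotR * fuse (Lbar z) ((Rmat (ω * z) z₂).submatrix Prod.swap Prod.swap) s u) b (a, c) =
        (1 + ω ^ 2 * z) *
          (blk ((Rmat (ω ^ 2 * z) z₂).submatrix Prod.swap Prod.swap) s u * quotR) b (a, c) := by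
    simp only [Fin.forall_fin_two, forall_zmod_three, quotR, submatrix_apply, Prod.swap_prod_mk,
      mul_apply, fuse_apply, blk_apply, Fintype.sum_prod_type, Fin.sum_univ_two, sum_zmod_three,
      of_apply, Lbar_apply, Rmat_apply, zmod_three_table, if_true, if_false, zero_mul, mul_zero,
      add_zero, zero_add, sub_zero, sub_self, zero_ne_one, one_ne_zero, mul_one, one_mul,
      ωpow_zero, ωpow_one, ωpow_two]
    have hω := ω_sq_add
    simp only [rcoef_table, true_and, and_true]
    repeat' apply And.intro
    all_goals grind
  ext b ⟨a, c⟩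
  exact h _ _ _ _ _

lemma fuse_mul_inclR (z z₂ : ℂ) (s u : ZMod 3) :
    fuse (Lbar z) ((Rmat (ω * z) z₂).submatrix Prod.swap Prod.swap) s u * inclR =
      (-(ω * z - 1)) •
        (inclR * blk ((Rmat z z₂).submatrix Prod.swap Prod.swap) s u) := by
  have h : ∀ b : ZMod 3, ∀ a : Fin 2, ∀ c s u : ZMod 3,
      (fuse (Lbar z) ((Rmat (ω * z) z₂).submatrix Prod.swap Prod.swap) s u * inclR) (a, c) b =
        (-(ω * z - 1)) *
          (inclR * blk ((Rmat z z₂).submatrix Prod.swap Prod.swap) s u) (a, c) b := by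
    simp only [Fin.forall_fin_two, forall_zmod_three, inclR, submatrix_apply, Prod.swap_prod_mk,
      mul_apply, fuse_apply, blk_apply, Fintype.sum_prod_type, Fin.sum_univ_two, sum_zmod_three,
      of_apply, Lbar_apply, Rmat_apply, zmod_three_table, if_true, if_false, zero_mul, mul_zero,
      add_zero, zero_add, sub_zero, sub_self, zero_ne_one, one_ne_zero, mul_one, one_mul,
      ωpow_zero, ωpow_one, ωpow_two]
    have hω := ω_sq_add
    simp only [rcoef_table, true_and, and_true]
    repeat' apply And.intro
    all_goals grind
  ext ⟨a, c⟩ b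
  exact h _ _ _ _ _

/-- At parameter 0 the rotation z ↦ ωz is invisible, so the second half of a braided row reproduces
R(0,0) with scalars 1 here and -1 on the subspace. -/
lemma quotR_mul_fuse_zero (s u : ZMod 3) :
    quotR * fuse (Lop 0) (Rmat 0 0) s u = (1 : ℂ) • (blk (Rmat 0 0) s u * quotR) := by
  have h : ∀ b : ZMod 3, ∀ a : Fin 2, ∀ c s u : ZMod 3,
      (quotR * fuse (Lop 0) (Rmat 0 0) s u) b (a, c) = (blk (Rmat 0 0) s u * quotR) b (a, c) := by
    simp only [Fin.forall_fin_two, forall_zmod_three, quotR, ite_self,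
      mul_apply, fuse_apply, blk_apply, Fintype.sum_prod_type, Fin.sum_univ_two, sum_zmod_three,
      of_apply, Lop_apply, Rmat_apply, zmod_three_table, if_true, if_false, zero_mul, mul_zero,
      add_zero, zero_add, sub_zero, sub_self, zero_ne_one, one_ne_zero, mul_one, one_mul,
      ωpow_zero, ωpow_one, ωpow_two]
    have hω := ω_sq_add
    simp only [rcoef_table, true_and, and_true]
    repeat' apply And.intro
    all_goals grind
  ext b ⟨a, c⟩
  rw [one_smul]
  exact h _ _ _ _ _

lemma fuse_zero_mul_inclR (s u : ZMod 3) :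
    fuse (Lop 0) (Rmat 0 0) s u * inclR = (-1 : ℂ) • (inclR * blk (Rmat 0 0) s u) := by
  have h : ∀ b : ZMod 3, ∀ a : Fin 2, ∀ c s u : ZMod 3,
      (fuse (Lop 0) (Rmat 0 0) s u * inclR) (a, c) b =
        (-1) * (inclR * blk (Rmat 0 0) s u) (a, c) b := by
    simp only [Fin.forall_fin_two, forall_zmod_three, inclR, ite_self,
      mul_apply, fuse_apply, blk_apply, Fintype.sum_prod_type, Fin.sum_univ_two, sum_zmod_three,
      of_apply, Lop_apply, Rmat_apply, zmod_three_table, if_true, if_false, zero_mul, mul_zero,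
      add_zero, zero_add, sub_zero, sub_self, zero_ne_one, one_ne_zero, mul_one, one_mul,
      ωpow_zero, ωpow_one, ωpow_two]
    have hω := ω_sq_add
    simp only [rcoef_table, true_and, and_true]
    repeat' apply And.intro
    all_goals grind
  ext ⟨a, c⟩ b
  exact h _ _ _ _ _

/-! ### The exchange map of the double rows. -/

/-- The linear map with which the double rows of `L` and `R` are interchanged. -/
def swapMap (p q : ℂ) : Matrix (Fin 2 × ZMod 3) (Fin 2 × ZMod 3) ℂ →ₗ[ℂ]
    Matrix (Fin 2 × ZMod 3) (Fin 2 × ZMod 3) ℂ where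
  toFun X := Matrix.of fun i j =>
    if j.1 = 0 then p * ωpow i.2 * X i (1, j.2) + q * X (i.1, i.2 - 1) (0, j.2)
    else p * ωpow (2 + 2 * i.2) * X i (0, j.2) + q * X (i.1, i.2 + 1) (1, j.2)
  map_add' X Y := by
    ext i j
    simp only [of_apply, Matrix.add_apply]
    split_ifs <;> ring
  map_smul' c X := by
    ext i j
    simp only [of_apply, Matrix.smul_apply, smul_eq_mul, RingHom.id_apply]
    split_ifs <;> ring

lemma swapMap_apply_zero (p q : ℂ) (X : Matrix (Fin 2 × ZMod 3) (Fin 2 × ZMod 3) ℂ) (a : Fin 2)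
    (α δ : ZMod 3) : swapMap p q X (a, α) (0, δ) =
      p * ωpow α * X (a, α) (1, δ) + q * X (a, α - 1) (0, δ) := rfl

lemma swapMap_apply_one (p q : ℂ) (X : Matrix (Fin 2 × ZMod 3) (Fin 2 × ZMod 3) ℂ) (a : Fin 2)
    (α δ : ZMod 3) : swapMap p q X (a, α) (1, δ) =
      p * ωpow (2 + 2 * α) * X (a, α) (0, δ) + q * X (a, α + 1) (1, δ) := rfl

lemma kronecker_one_mul_mul_apply {A B : Type} [Fintype A] [DecidableEq A] [Fintype B]
    [DecidableEq B] (M : Matrix A A ℂ) (N : Matrix B B ℂ) (X : Matrix (A × B) (A × B) ℂ)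
    (a d : A) (α δ : B) :
    ((M ⊗ₖ (1 : Matrix B B ℂ)) * X * ((1 : Matrix A A ℂ) ⊗ₖ N)) (a, α) (d, δ) =
      ∑ b, ∑ γ, M a b * X (b, α) (d, γ) * N γ δ := by
  simp only [mul_apply, Fintype.sum_prod_type, kroneckerMap_apply, one_apply, mul_ite, mul_one,
    mul_zero, ite_mul, one_mul, zero_mul, Finset.sum_ite_eq, Finset.mem_univ, if_true,
    Finset.sum_mul]
  rw [Finset.sum_comm' (t' := Finset.univ) (s' := fun _ => Finset.univ) (by simp)]
  simp only [Finset.sum_ite_eq', Finset.mem_univ,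
    if_true]
  exact Finset.sum_comm

lemma one_kronecker_mul_mul_apply {A B : Type} [Fintype A] [DecidableEq A] [Fintype B]
    [DecidableEq B] (M : Matrix A A ℂ) (N : Matrix B B ℂ) (X : Matrix (A × B) (A × B) ℂ)
    (a d : A) (α δ : B) :
    (((1 : Matrix A A ℂ) ⊗ₖ N) * X * (M ⊗ₖ (1 : Matrix B B ℂ))) (a, α) (d, δ) =
      ∑ b, ∑ γ, N α γ * X (a, γ) (b, δ) * M b d := by
  simp only [mul_apply, Fintype.sum_prod_type, kroneckerMap_apply, one_apply, mul_ite, mul_one,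
    mul_zero, ite_mul, one_mul, zero_mul, Finset.sum_mul, Finset.sum_ite_irrel,
    Finset.sum_const_zero]
  simp only [Finset.sum_ite_eq, Finset.sum_ite_eq', Finset.mem_univ, if_true]

/-- `swapMap` only touches the three-dimensional row index and the two-dimensional column index,
whereas M and N act on the other two. -/
lemma swapMap_kronecker (p q : ℂ) (M : Matrix (Fin 2) (Fin 2) ℂ)
    (N : Matrix (ZMod 3) (ZMod 3) ℂ) (X : Matrix (Fin 2 × ZMod 3) (Fin 2 × ZMod 3) ℂ) :
    swapMap p q ((M ⊗ₖ (1 : Matrix (ZMod 3) (ZMod 3) ℂ)) * X *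
      ((1 : Matrix (Fin 2) (Fin 2) ℂ) ⊗ₖ N)) =
      (M ⊗ₖ (1 : Matrix (ZMod 3) (ZMod 3) ℂ)) * swapMap p q X *
        ((1 : Matrix (Fin 2) (Fin 2) ℂ) ⊗ₖ N) := by
  ext ⟨a, α⟩ ⟨d, δ⟩
  fin_cases d
  · simp only [Fin.zero_eta, swapMap_apply_zero, kronecker_one_mul_mul_apply, Finset.mul_sum,
      ← Finset.sum_add_distrib]
    exact Finset.sum_congr rfl fun b _ => Finset.sum_congr rfl fun γ _ => by ring
  · simp only [Fin.mk_one, swapMap_apply_one, kronecker_one_mul_mul_apply, Finset.mul_sum,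
      ← Finset.sum_add_distrib]
    exact Finset.sum_congr rfl fun b _ => Finset.sum_congr rfl fun γ _ => by ring

/-- By `swapMap_kronecker` the spectators M and N factor out, so the exchange need only be checked
with both equal to 1. -/
lemma exchanges_swapMap {p q : ℂ} {L' : Matrix (Fin 2 × ZMod 3) (Fin 2 × ZMod 3) ℂ}
    {R : Matrix (ZMod 3 × ZMod 3) (ZMod 3 × ZMod 3) ℂ}
    (h : ∀ (X : Matrix (Fin 2 × ZMod 3) (Fin 2 × ZMod 3) ℂ) (a : Fin 2) (α : ZMod 3) (d : Fin 2)
      (δ t t' : ZMod 3),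
      ∑ x, swapMap p q (((1 : Matrix (Fin 2) (Fin 2) ℂ) ⊗ₖ blk R x t') * X *
        (blk L' t x ⊗ₖ (1 : Matrix (ZMod 3) (ZMod 3) ℂ))) (a, α) (d, δ) =
      ∑ x, (((1 : Matrix (Fin 2) (Fin 2) ℂ) ⊗ₖ blk R t x) * swapMap p q X *
        (blk L' x t' ⊗ₖ (1 : Matrix (ZMod 3) (ZMod 3) ℂ))) (a, α) (d, δ)) :
    Exchanges (swapMap p q) L' R := by
  intro M N X t t'
  have h1 : ∀ (Y : Matrix (Fin 2 × ZMod 3) (Fin 2 × ZMod 3) ℂ) (x y x' y' : ZMod 3),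
      (M ⊗ₖ blk R x y) * Y * (blk L' x' y' ⊗ₖ N) =
        (M ⊗ₖ (1 : Matrix (ZMod 3) (ZMod 3) ℂ)) *
          (((1 : Matrix (Fin 2) (Fin 2) ℂ) ⊗ₖ blk R x y) * Y *
            (blk L' x' y' ⊗ₖ (1 : Matrix (ZMod 3) (ZMod 3) ℂ))) *
              ((1 : Matrix (Fin 2) (Fin 2) ℂ) ⊗ₖ N) := by
    intro Y x y x' y'
    have e1 : M ⊗ₖ blk R x y = (M ⊗ₖ (1 : Matrix (ZMod 3) (ZMod 3) ℂ)) *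
        ((1 : Matrix (Fin 2) (Fin 2) ℂ) ⊗ₖ blk R x y) := by
      rw [← mul_kronecker_mul, mul_one, one_mul]
    have e2 : blk L' x' y' ⊗ₖ N = (blk L' x' y' ⊗ₖ (1 : Matrix (ZMod 3) (ZMod 3) ℂ)) *
        ((1 : Matrix (Fin 2) (Fin 2) ℂ) ⊗ₖ N) := by
      rw [← mul_kronecker_mul, mul_one, one_mul]
    rw [e1, e2]
    simp only [Matrix.mul_assoc]
  simp only [h1, swapMap_kronecker]
  rw [← Finset.sum_mul, ← Finset.mul_sum, ← Finset.sum_mul, ← Finset.mul_sum]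
  congr 2
  ext ⟨a, α⟩ ⟨d, δ⟩
  rw [Matrix.sum_apply, Matrix.sum_apply]
  exact h X a α d δ t t'

lemma exchanges_Lbar (z z₂ : ℂ) : Exchanges (swapMap (z ^ 2) 1) (Lbar z) (Rmat (ω * z) z₂) := by
  refine exchanges_swapMap fun X a α d δ t t' => ?_
  -- The indices a and δ are spectators; six entries of X remain as free unknowns.
  obtain ⟨f, hf⟩ : ∃ f : ZMod 3 → Fin 2 → ℂ, ∀ α d, X (a, α) (d, δ) = f α d := ⟨_, fun _ _ => rfl⟩
  revert α d t t'
  simp only [Fin.forall_fin_two, forall_zmod_three, swapMap_apply_zero, swapMap_apply_one,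
    one_kronecker_mul_mul_apply, blk_apply, Fin.sum_univ_two, sum_zmod_three, hf,
    Lbar_apply, Rmat_apply, zmod_three_table, if_true, if_false, zero_mul, mul_zero,
    add_zero, zero_add, sub_zero, sub_self, zero_ne_one, one_ne_zero, mul_one, one_mul,
    ωpow_zero, ωpow_one, ωpow_two]
  clear hf X
  have hω := ω_sq_add
  simp only [rcoef_table]
  generalize f 0 0 = x₀, f 0 1 = y₀, f 1 0 = x₁, f 1 1 = y₁, f 2 0 = x₂, f 2 1 = y₂
  repeat' apply And.intro
  all_goals grind

lemma exchanges_Lop_zero (z₁ z₂ : ℂ) : Exchanges (swapMap 1 0) (Lop 0) (Rmat z₁ z₂) := by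
  refine exchanges_swapMap fun X a α d δ t t' => ?_
  obtain ⟨f, hf⟩ : ∃ f : ZMod 3 → Fin 2 → ℂ, ∀ α d, X (a, α) (d, δ) = f α d := ⟨_, fun _ _ => rfl⟩
  revert α d t t'
  simp only [Fin.forall_fin_two, forall_zmod_three, swapMap_apply_zero, swapMap_apply_one,
    one_kronecker_mul_mul_apply, blk_apply, Fin.sum_univ_two, sum_zmod_three, hf, ite_self,
    Lop_apply, Rmat_apply, zmod_three_table, if_true, if_false, zero_mul, mul_zero,
    add_zero, zero_add, sub_zero, sub_self, zero_ne_one, one_ne_zero, mul_one, one_mul,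
    ωpow_zero, ωpow_one, ωpow_two]
  clear hf X
  have hω := ω_sq_add
  simp only [rcoef_table]
  generalize f 0 0 = x₀, f 0 1 = y₀, f 1 0 = x₁, f 1 1 = y₁, f 2 0 = x₂, f 2 1 = y₂
  repeat' apply And.intro
  all_goals grind

/-- The matrix that recovers the trace of `X` from `swapMap p q X`. -/
def swapDual (p q : ℂ) : Matrix (Fin 2 × ZMod 3) (Fin 2 × ZMod 3) ℂ := Matrix.of fun i j =>
  if i.1 = 0 then
    (if j.1 = 0 then (if j.2 = i.2 + 1 then q else 0)
      else if j.2 = i.2 then -p * ωpow (2 * i.2) else 0)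
  else
    (if j.1 = 0 then (if j.2 = i.2 then -p * ωpow (i.2 + 1) else 0)
      else if j.2 = i.2 - 1 then q else 0)

/-- This supplies K and d in `fusion`. The value q² - p² becomes 1 - z⁴ for open ends, the
denominator of f and g, and -1 in the braided case. -/
lemma trace_swapDual_mul (p q : ℂ) (X : Matrix (Fin 2 × ZMod 3) (Fin 2 × ZMod 3) ℂ) :
    (q ^ 2 - p ^ 2) * X.trace = (swapDual p q * swapMap p q X).trace := by
  simp only [trace, diag_apply, mul_apply, Fintype.sum_prod_type, Fin.sum_univ_two, sum_zmod_three,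
    swapDual, of_apply, swapMap_apply_zero, swapMap_apply_one, zmod_three_table, if_true, if_false,
    zero_mul, mul_zero, add_zero, zero_add, sub_self, zero_ne_one, one_ne_zero, mul_one,
    ωpow_zero, ωpow_one, ωpow_two]
  have h3 := ω_pow_three
  grind

/-- The scalar here times that of `quotR_mul_swapDual` is the quadratic numerator of f for p = z², q
= 1; those of `swapMap_one_mul_inclR` and `swapDual_mul_inclL` give that of g. -/
lemma quotL_mul_swapMap_one (p q : ℂ) :
    quotL * swapMap p q 1 = (q + ω ^ 2 * p) • quotR := by
  have h : ∀ b : ZMod 3, ∀ a : Fin 2, ∀ c : ZMod 3,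
      (quotL * swapMap p q 1) b (a, c) = (q + ω ^ 2 * p) * quotR b (a, c) := by
    simp only [Fin.forall_fin_two, forall_zmod_three, mul_apply, Fintype.sum_prod_type,
      Fin.sum_univ_two, sum_zmod_three, quotL, quotR, of_apply, one_apply, Prod.mk.injEq,
      swapMap_apply_zero, swapMap_apply_one, zmod_three_table, if_true, if_false, zero_mul,
      mul_zero, add_zero, zero_add, sub_self, zero_ne_one, one_ne_zero, mul_one, one_mul,
      ωpow_zero, ωpow_one, ωpow_two, and_self, and_false, true_and, and_true]
    have h3 := ω_pow_three
    repeat' apply And.intro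
    all_goals grind
  ext b ⟨a, c⟩
  exact h _ _ _

lemma swapMap_one_mul_inclR (p q : ℂ) :
    swapMap p q 1 * inclR = (ω ^ 2 * q - ω * p) • inclL := by
  have h : ∀ b : ZMod 3, ∀ a : Fin 2, ∀ c : ZMod 3,
      (swapMap p q 1 * inclR) (a, c) b = (ω ^ 2 * q - ω * p) * inclL (a, c) b := by
    simp only [Fin.forall_fin_two, forall_zmod_three, mul_apply, Fintype.sum_prod_type,
      Fin.sum_univ_two, sum_zmod_three, inclL, inclR, of_apply, one_apply, Prod.mk.injEq,
      swapMap_apply_zero, swapMap_apply_one, zmod_three_table, if_true, if_false, zero_mul,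
      mul_zero, add_zero, zero_add, sub_self, zero_ne_one, one_ne_zero, mul_one,
      ωpow_zero, ωpow_one, ωpow_two, and_self, and_false, true_and, and_true]
    have h3 := ω_pow_three
    repeat' apply And.intro
    all_goals grind
  ext ⟨a, c⟩ b
  exact h _ _ _

lemma swapDual_mul_inclL (p q : ℂ) :
    swapDual p q * inclL = (ω * q + ω ^ 2 * p) • inclR := by
  have h : ∀ b : ZMod 3, ∀ a : Fin 2, ∀ c : ZMod 3,
      (swapDual p q * inclL) (a, c) b = (ω * q + ω ^ 2 * p) * inclR (a, c) b := by
    simp only [Fin.forall_fin_two, forall_zmod_three, mul_apply, Fintype.sum_prod_type,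
      Fin.sum_univ_two, sum_zmod_three, inclL, inclR, swapDual, of_apply,
      zmod_three_table, if_true, if_false, zero_mul,
      mul_zero, add_zero, zero_add, sub_self, zero_ne_one, one_ne_zero, mul_one,
      ωpow_zero, ωpow_one, ωpow_two, true_and, and_true]
    have h3 := ω_pow_three
    repeat' apply And.intro
    all_goals grind
  ext ⟨a, c⟩ b
  exact h _ _ _

lemma quotR_mul_swapDual (p q : ℂ) :
    quotR * swapDual p q = (q - ω * p) • quotL := by
  have h : ∀ b : ZMod 3, ∀ a : Fin 2, ∀ c : ZMod 3,
      (quotR * swapDual p q) b (a, c) = (q - ω * p) * quotL b (a, c) := by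
    simp only [Fin.forall_fin_two, forall_zmod_three, mul_apply, Fintype.sum_prod_type,
      Fin.sum_univ_two, sum_zmod_three, quotL, quotR, swapDual, of_apply,
      zmod_three_table, if_true, if_false, zero_mul,
      mul_zero, add_zero, zero_add, sub_self, zero_ne_one, one_ne_zero, mul_one, one_mul,
      ωpow_zero, ωpow_one, ωpow_two, true_and, and_true]
    have h3 := ω_pow_three
    repeat' apply And.intro
    all_goals grind
  ext b ⟨a, c⟩
  exact h _ _ _

lemma quotL_mul_sectL : quotL * sectL = 1 := by
  have h : ∀ b c : ZMod 3, (quotL * sectL) b c = (1 : Matrix (ZMod 3) (ZMod 3) ℂ) b c := by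
    simp only [forall_zmod_three, mul_apply, Fintype.sum_prod_type, one_apply,
      Fin.sum_univ_two, sum_zmod_three, quotL, sectL, of_apply,
      zmod_three_table, if_true, if_false, zero_mul,
      mul_zero, add_zero, zero_add, sub_self, one_ne_zero, mul_one, one_mul,
      ωpow_zero, ωpow_one, ωpow_two, true_and, and_true]
    have h3 := ω_pow_three
    repeat' apply And.intro
    all_goals grind
  ext b c
  exact h _ _

lemma retrL_mul_inclL : retrL * inclL = 1 := by
  have h : ∀ b c : ZMod 3, (retrL * inclL) b c = (1 : Matrix (ZMod 3) (ZMod 3) ℂ) b c := by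
    simp only [forall_zmod_three, mul_apply, Fintype.sum_prod_type, one_apply,
      Fin.sum_univ_two, sum_zmod_three, retrL, inclL, of_apply,
      zmod_three_table, if_true, if_false, zero_mul,
      mul_zero, add_zero, zero_add, sub_self, one_ne_zero, mul_one,
      ωpow_zero, ωpow_one, ωpow_two, true_and, and_true]
    have h3 := ω_pow_three
    repeat' apply And.intro
    all_goals grind
  ext b c
  exact h _ _

lemma sectL_mul_quotL_add : sectL * quotL + inclL * retrL = 1 := by
  have h : ∀ (a d : Fin 2) (b c : ZMod 3), (sectL * quotL + inclL * retrL) (a, b) (d, c) =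
      (1 : Matrix (Fin 2 × ZMod 3) (Fin 2 × ZMod 3) ℂ) (a, b) (d, c) := by
    simp only [Fin.forall_fin_two, forall_zmod_three, mul_apply, one_apply, Matrix.add_apply,
      sum_zmod_three, quotL, sectL, retrL, inclL, of_apply, Prod.mk.injEq,
      zmod_three_table, if_true, if_false, zero_mul, zero_ne_one,
      mul_zero, add_zero, zero_add, sub_self, one_ne_zero, mul_one, one_mul,
      ωpow_zero, ωpow_one, ωpow_two, true_and, and_true, and_self, and_false]
    have h3 := ω_pow_three
    repeat' apply And.intro
    all_goals grind
  ext ⟨a, b⟩ ⟨d, c⟩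
  exact h _ _ _ _

/-! ### The fusion relation for the three boundary conditions. -/

lemma fuse_one_one {A B : Type} [DecidableEq A] [DecidableEq B] (s u : ZMod 3) :
    fuse (1 : Matrix (A × ZMod 3) (A × ZMod 3) ℂ) (1 : Matrix (B × ZMod 3) (B × ZMod 3) ℂ) s u =
      if s = u then 1 else 0 := by
  ext ⟨a, α⟩ ⟨d, δ⟩
  rw [fuse_apply]
  by_cases h : s = u <;> by_cases h1 : a = d <;> by_cases h2 : α = δ <;>
    simp [one_apply, h, h1, h2]

lemma blk_one {A : Type} [DecidableEq A] (s u : ZMod 3) :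
    blk (1 : Matrix (A × ZMod 3) (A × ZMod 3) ℂ) s u = if s = u then 1 else 0 := by
  ext a b
  by_cases h : s = u <;> by_cases h1 : a = b <;> simp [blk_apply, one_apply, h, h1]

lemma exchanges_id {A B : Type} [Fintype A] [Fintype B] [DecidableEq A] [DecidableEq B]
    (R : Matrix (B × ZMod 3) (B × ZMod 3) ℂ) :
    Exchanges LinearMap.id (1 : Matrix (A × ZMod 3) (A × ZMod 3) ℂ) R := by
  intro M N X t t'
  rw [Finset.sum_eq_single t, Finset.sum_eq_single t']
  · simp [blk_one]
  · intro x _ hx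
    simp [blk_one, hx]
  · simp
  · intro x _ hx
    simp [blk_one, Ne.symm hx]
  · simp

lemma t2_periodic (n : ℕ) (z : ℂ) :
    t2 .periodic n z = traceAux (prodDown n (Lop z) * prodUp n 1) := by
  rw [prodUp_one, mul_one]
  rfl

lemma t3_periodic (n : ℕ) (z₁ z₂ : ℂ) :
    t3 .periodic n z₁ z₂ = traceAux (prodDown n (Rmat z₁ z₂) * prodUp n 1) := by
  rw [prodUp_one, mul_one]
  rfl

lemma t2_mul_t3_periodic (n : ℕ) (z z₂ : ℂ) :
    t2 .periodic n z * t3 .periodic n (ω * z) z₂ =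
      fcoef .periodic n z • t3 .periodic n (ω ^ 2 * z) z₂ +
        gcoef .periodic n z • t3 .periodic n z z₂ := by
  have h := fusion (d := 1) (K := 1) (κf := 1) (κg := 1) (α := 1) (β := 1) (cf' := 1) (cg' := 1)
    (R' := 1) (Rf' := 1) (Rg' := 1) (Q' := quotL) (J' := inclL)
    (exchanges_id (Rmat (ω * z) z₂)) (quotL_mul_fuse z z₂) (fun s u => by
      rw [fuse_one_one, blk_one]; split_ifs <;> simp) (fuse_mul_inclL z z₂) (fun s u => by
      rw [fuse_one_one, blk_one]; split_ifs <;> simp) (by simp) (by simp)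
    (fun X => by simp) (by simp) (by simp) sectL_mul_quotL_add quotL_mul_sectL retrL_mul_inclL n
  simp only [one_mul, mul_one, one_smul] at h
  rw [t2_periodic, t3_periodic, t3_periodic, t3_periodic, h, fcoef, gcoef, add_comm 1]

/-- With p = 1, q = 0 all three terms acquire a common factor -1, which cancels. -/
lemma t2_mul_t3_braided (n : ℕ) (z z₂ : ℂ) :
    t2 .braided n z * t3 .braided n (ω * z) z₂ =
      fcoef .braided n z • t3 .braided n (ω ^ 2 * z) z₂ +
        gcoef .braided n z • t3 .braided n z z₂ := by
  have h := fusion (exchanges_Lop_zero (ω * z) z₂) (quotL_mul_fuse z z₂) quotR_mul_fuse_zero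
    (fuse_mul_inclL z z₂) fuse_zero_mul_inclR (quotL_mul_swapMap_one 1 0)
    (swapMap_one_mul_inclR 1 0) (trace_swapDual_mul 1 0) (quotR_mul_swapDual 1 0)
    (swapDual_mul_inclL 1 0) sectL_mul_quotL_add quotL_mul_sectL retrL_mul_inclL n
  have h3 := ω_pow_three
  have e1 : (0 - ω * 1) * (0 + ω ^ 2 * 1) * ((1 + ω ^ 2 * z) * 1) ^ n = -fcoef .braided n z := by
    rw [fcoef, mul_one (1 + ω ^ 2 * z)]
    linear_combination (-(1 + ω ^ 2 * z) ^ n) * h3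
  have e2 : (ω * 0 + ω ^ 2 * 1) * (ω ^ 2 * 0 - ω * 1) * ((ω * z - 1) * -1) ^ n =
      -gcoef .braided n z := by
    rw [gcoef, show (ω * z - 1) * -1 = 1 - ω * z by ring]
    linear_combination (-(1 - ω * z) ^ n) * h3
  rw [e1, e2] at h
  have e3 : ((0 : ℂ) ^ 2 - 1 ^ 2) = -1 := by norm_num
  rw [e3, neg_smul, neg_smul, neg_smul, one_smul, ← neg_add] at h
  exact neg_inj.mp h

/-- Here p = z² and q = 1, and 1 - z⁴ is cancelled. The sign (-1)^n in g comes from (ωz - 1)·(-(ωz -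
1)) at each site. -/
lemma t2_mul_t3_openEnds (n : ℕ) {z : ℂ} (hz : z ^ 4 ≠ 1) (z₂ : ℂ) :
    t2 .openEnds n z * t3 .openEnds n (ω * z) z₂ =
      fcoef .openEnds n z • t3 .openEnds n (ω ^ 2 * z) z₂ +
        gcoef .openEnds n z • t3 .openEnds n z z₂ := by
  have h := fusion (exchanges_Lbar z z₂) (quotL_mul_fuse z z₂) (quotR_mul_fuse z z₂)
    (fuse_mul_inclL z z₂) (fuse_mul_inclR z z₂) (quotL_mul_swapMap_one (z ^ 2) 1)
    (swapMap_one_mul_inclR (z ^ 2) 1) (trace_swapDual_mul (z ^ 2) 1) (quotR_mul_swapDual (z ^ 2) 1)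
    (swapDual_mul_inclL (z ^ 2) 1) sectL_mul_quotL_add quotL_mul_sectL retrL_mul_inclL n
  have h3 := ω_pow_three
  have hz' : 1 - z ^ 4 ≠ 0 := sub_ne_zero.mpr hz.symm
  have e1 : (1 - ω * z ^ 2) * (1 + ω ^ 2 * z ^ 2) * ((1 + ω ^ 2 * z) * (1 + ω ^ 2 * z)) ^ n =
      (1 - z ^ 4) * fcoef .openEnds n z := by
    rw [fcoef, ← sq, ← pow_mul]
    field_simp
  have e2 : (ω * 1 + ω ^ 2 * z ^ 2) * (ω ^ 2 * 1 - ω * z ^ 2) *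
      ((ω * z - 1) * -(ω * z - 1)) ^ n = (1 - z ^ 4) * gcoef .openEnds n z := by
    rw [gcoef, show (ω * z - 1) * -(ω * z - 1) = -1 * (1 - ω * z) ^ 2 by ring, mul_pow, ← pow_mul,
      show (ω * 1 + ω ^ 2 * z ^ 2) * (ω ^ 2 * 1 - ω * z ^ 2) =
        (1 - ω ^ 2 * z ^ 2) * (1 + ω * z ^ 2) by linear_combination (1 + ω * z ^ 2) * h3]
    field_simp
  rw [e1, e2, mul_smul, mul_smul, ← smul_add, one_pow, show (z ^ 2) ^ 2 = z ^ 4 by ring] at h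
  exact smul_right_injective _ hz' h

/-- The fusion of `t2` and `t3`. -/
theorem t2_mul_t3 (m : Boundary) (n : ℕ) {z : ℂ} (hz : IsRegular m z) (z₂ : ℂ) :
    t2 m n z * t3 m n (ω * z) z₂ =
      fcoef m n z • t3 m n (ω ^ 2 * z) z₂ + gcoef m n z • t3 m n z z₂ := by
  cases m with
  | periodic => exact t2_mul_t3_periodic n z z₂
  | braided => exact t2_mul_t3_braided n z z₂
  | openEnds => exact t2_mul_t3_openEnds n hz z₂

/-! ### Hermiticity of t2 and conjugation of t3. -/

section Conj

variable {A : Type} [Fintype A] [DecidableEq A]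

omit [Fintype A] [DecidableEq A] in
lemma blk_map_conj (M : Matrix (A × ZMod 3) (A × ZMod 3) ℂ) (s t : ZMod 3) :
    blk (M.map (starRingEnd ℂ)) s t = (blk M s t).map (starRingEnd ℂ) := rfl

lemma map_conj_sum {ι : Type*} (s : Finset ι) (f : ι → Matrix A A ℂ) :
    (∑ i ∈ s, f i).map (starRingEnd ℂ) = ∑ i ∈ s, (f i).map (starRingEnd ℂ) :=
  map_sum (starRingEnd ℂ).mapMatrix f s

lemma map_conj_mul (M N : Matrix A A ℂ) :
    (M * N).map (starRingEnd ℂ) = M.map (starRingEnd ℂ) * N.map (starRingEnd ℂ) :=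
  map_mul (starRingEnd ℂ).mapMatrix M N

lemma map_conj_one : (1 : Matrix A A ℂ).map (starRingEnd ℂ) = 1 :=
  map_one (starRingEnd ℂ).mapMatrix

lemma chain_map_conj (M N : Matrix (A × ZMod 3) (A × ZMod 3) ℂ) (n : ℕ) (s u : Config n) :
    chain (M.map (starRingEnd ℂ)) (N.map (starRingEnd ℂ)) n s u =
      (chain M N n s u).map (starRingEnd ℂ) := by
  induction n with
  | zero => exact map_conj_one.symm
  | succ n ih =>
    simp only [chain, ih, map_conj_sum, map_conj_mul, blk_map_conj]

omit [DecidableEq A] in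
lemma trace_map_conj (M : Matrix A A ℂ) :
    (M.map (starRingEnd ℂ)).trace = starRingEnd ℂ M.trace := by
  simp [trace]

/-- A gauge transformation of the auxiliary space that relates a double row with the complex
conjugate of its transpose makes the transfer matrix Hermitian. -/
lemma chain_gauge {M N : Matrix (A × ZMod 3) (A × ZMod 3) ℂ} {Θ : Matrix A A ℂ →ₗ[ℂ] Matrix A A ℂ}
    {σ : ℂ} (h1 : Θ 1 = σ • 1)
    (hΘ : ∀ X s u, Θ (∑ t, blk M s t * X * blk N t u) =
      ∑ t, (blk M u t).map (starRingEnd ℂ) * Θ X * (blk N t s).map (starRingEnd ℂ))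
    (n : ℕ) (s u : Config n) :
    Θ (chain M N n s u) = σ • (chain M N n u s).map (starRingEnd ℂ) := by
  induction n with
  | zero => rw [chain, chain, map_conj_one, h1]
  | succ n ih =>
    rw [chain, hΘ, chain, map_conj_sum, Finset.smul_sum]
    refine Finset.sum_congr rfl fun t _ => ?_
    rw [ih, map_conj_mul, map_conj_mul, Matrix.mul_smul, Matrix.smul_mul]

lemma conj_traceAux_of_gauge {M N : Matrix (A × ZMod 3) (A × ZMod 3) ℂ}
    {Θ : Matrix A A ℂ →ₗ[ℂ] Matrix A A ℂ} {σ : ℂ} (hσ : σ ≠ 0) (h1 : Θ 1 = σ • 1)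
    (htr : ∀ X, (Θ X).trace = σ * X.trace)
    (hΘ : ∀ X s u, Θ (∑ t, blk M s t * X * blk N t u) =
      ∑ t, (blk M u t).map (starRingEnd ℂ) * Θ X * (blk N t s).map (starRingEnd ℂ))
    (n : ℕ) (s u : Config n) :
    starRingEnd ℂ (traceAux (prodDown n M * prodUp n N) u s) =
      traceAux (prodDown n M * prodUp n N) s u := by
  have h := congrArg trace (chain_gauge h1 hΘ n s u)
  rw [htr, trace_smul, trace_map_conj, smul_eq_mul] at h
  rw [traceAux_prodDown_mul_prodUp, traceAux_prodDown_mul_prodUp, mul_left_cancel₀ hσ h]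

end Conj

/-- The gauge transformations of the two-dimensional auxiliary space. -/
def gaugeMap (s₁ s₂ s₃ : ℂ) : Matrix (Fin 2) (Fin 2) ℂ →ₗ[ℂ] Matrix (Fin 2) (Fin 2) ℂ where
  toFun X := !![s₁ * X 0 0 + s₂ * X 1 1, s₃ * X 1 0; s₃ * X 0 1, s₁ * X 1 1 + s₂ * X 0 0]
  map_add' X Y := by
    ext i j
    fin_cases i <;> fin_cases j <;> simp <;> ring
  map_smul' c X := by
    ext i j
    fin_cases i <;> fin_cases j <;> simp <;> ring

lemma gaugeMap_apply (s₁ s₂ s₃ : ℂ) (X : Matrix (Fin 2) (Fin 2) ℂ) : gaugeMap s₁ s₂ s₃ X =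
    !![s₁ * X 0 0 + s₂ * X 1 1, s₃ * X 1 0; s₃ * X 0 1, s₁ * X 1 1 + s₂ * X 0 0] := rfl

lemma gaugeMap_one (s₁ s₂ s₃ : ℂ) : gaugeMap s₁ s₂ s₃ 1 = (s₁ + s₂) • 1 := by
  ext i j
  fin_cases i <;> fin_cases j <;> simp [gaugeMap_apply]

lemma trace_gaugeMap (s₁ s₂ s₃ : ℂ) (X : Matrix (Fin 2) (Fin 2) ℂ) :
    (gaugeMap s₁ s₂ s₃ X).trace = (s₁ + s₂) * X.trace := by
  simp only [trace_fin_two, gaugeMap_apply, of_apply, cons_val', cons_val_zero, cons_val_one,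
    cons_val_fin_one]
  ring

/-- For real x the first summand is imaginary and the second real, and they never vanish together.
-/
lemma gauge_openEnds_ne_zero (x : ℝ) : (x : ℂ) ^ 2 * (ω ^ 2 - ω) + (1 - (x : ℂ) ^ 4) ≠ 0 := by
  intro h
  have h' := congrArg (starRingEnd ℂ) h
  simp only [map_add, map_mul, map_sub, map_pow, map_one, map_zero, Complex.conj_ofReal, conj_ω]
    at h'
  have h3 := ω_pow_three
  have hx : (x : ℂ) ^ 2 * (ω * (ω - 1)) = 0 := by
    linear_combination (1 / 2) * h - (1 / 2) * h' + (1 / 2) * ω * (x : ℂ) ^ 2 * h3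
  rcases mul_eq_zero.mp hx with h0 | h0
  · have h4 : (x : ℂ) ^ 4 = 0 := by linear_combination (x : ℂ) ^ 2 * h0
    rw [h0, h4] at h
    norm_num at h
  · exact mul_ne_zero ω_ne_zero (sub_ne_zero.mpr ω_ne_one) h0

/-- `gaugeMap 0 1 1` is conjugation by the flip of the two auxiliary basis vectors. -/
lemma conj_t2_periodic (n : ℕ) (x : ℝ) (s u : Config n) :
    starRingEnd ℂ (t2 .periodic n x u s) = t2 .periodic n x s u := by
  have h3 := ω_pow_three
  have hω := ω_sq_add
  rw [t2_periodic]
  refine conj_traceAux_of_gauge (Θ := gaugeMap 0 1 1)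
    ?_ (gaugeMap_one _ _ _) (trace_gaugeMap _ _ _) (fun X s u => ?_) n s u
  · norm_num
  · have hs : ∀ (f : ZMod 3 → Matrix (Fin 2) (Fin 2) ℂ) X u,
        ∑ t, f t * X * blk (1 : Matrix (Fin 2 × ZMod 3) (Fin 2 × ZMod 3) ℂ) t u = f u * X := by
      intro f X u
      rw [Finset.sum_eq_single u]
      · simp [blk_one]
      · intro t _ ht
        simp [blk_one, ht]
      · simp
    have hs' : ∀ (f : ZMod 3 → Matrix (Fin 2) (Fin 2) ℂ) X u, ∑ t, f t * X *
        (blk (1 : Matrix (Fin 2 × ZMod 3) (Fin 2 × ZMod 3) ℂ) t u).map (starRingEnd ℂ) =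
          f u * X := by
      intro f X u
      rw [← hs f X u]
      refine Finset.sum_congr rfl fun t _ => ?_
      congr 1
      ext i j
      by_cases ht : t = u <;> by_cases hij : i = j <;> simp [blk_one, ht, hij]
    rw [hs (fun t => blk (Lop x) s t), hs' (fun t => (blk (Lop x) u t).map (starRingEnd ℂ))]
    revert s u
    simp only [forall_zmod_three, gaugeMap_apply, Matrix.ext_iff.symm,
      Fin.forall_fin_two, mul_apply, Fin.sum_univ_two, map_apply, blk_apply,
      Lop_apply, of_apply, cons_val', cons_val_zero, cons_val_one,
      cons_val_fin_one, zmod_three_table, if_true, if_false, zero_mul,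
      add_zero, zero_add, sub_zero, sub_self, zero_ne_one, one_ne_zero, one_mul,
      ωpow_zero, ωpow_one, ωpow_two, map_zero, map_one, map_pow, conj_ω,
      Complex.conj_ofReal]
    generalize (x : ℂ) = z
    generalize X 0 0 = a, X 0 1 = b, X 1 0 = c, X 1 1 = d
    repeat' apply And.intro
    all_goals grind

/-- The factor ω off the diagonal means that this gauge map is not a similarity; only its linearity
and its effect on traces and on the identity matter. -/
lemma conj_t2_braided (n : ℕ) (x : ℝ) (s u : Config n) :
    starRingEnd ℂ (t2 .braided n x u s) = t2 .braided n x s u := by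
  have h3 := ω_pow_three
  have hω := ω_sq_add
  refine conj_traceAux_of_gauge (Θ := gaugeMap 0 1 ω)
    ?_ (gaugeMap_one _ _ _) (trace_gaugeMap _ _ _) (fun X s u => ?_) n s u
  · norm_num
  · revert s u
    simp only [forall_zmod_three, sum_zmod_three, gaugeMap_apply, Matrix.ext_iff.symm,
      Fin.forall_fin_two, Matrix.add_apply, mul_apply, Fin.sum_univ_two, map_apply, blk_apply,
      Lop_apply, ite_self, of_apply, cons_val', cons_val_zero, cons_val_one,
      cons_val_fin_one, zmod_three_table, if_true, if_false, zero_mul, mul_zero,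
      add_zero, zero_add, sub_zero, sub_self, zero_ne_one, one_ne_zero, mul_one, one_mul,
      ωpow_zero, ωpow_one, ωpow_two, map_zero, map_one, map_pow, conj_ω,
      Complex.conj_ofReal]
    generalize (x : ℂ) = z
    generalize X 0 0 = a, X 0 1 = b, X 1 0 = c, X 1 1 = d
    repeat' apply And.intro
    all_goals grind

lemma conj_t2_openEnds (n : ℕ) (x : ℝ) (s u : Config n) :
    starRingEnd ℂ (t2 .openEnds n x u s) = t2 .openEnds n x s u := by
  have h3 := ω_pow_three
  have hω := ω_sq_add
  refine conj_traceAux_of_gauge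
    (Θ := gaugeMap (x ^ 2 * (ω ^ 2 - ω)) (1 - x ^ 4) (ω ^ 2 - ω * x ^ 4))
    (gauge_openEnds_ne_zero x) (gaugeMap_one _ _ _) (trace_gaugeMap _ _ _) (fun X s u => ?_) n s u
  · revert s u
    simp only [forall_zmod_three, sum_zmod_three, gaugeMap_apply, Matrix.ext_iff.symm,
      Fin.forall_fin_two, Matrix.add_apply, mul_apply, Fin.sum_univ_two, map_apply, blk_apply,
      Lop_apply, Lbar_apply, of_apply, cons_val', cons_val_zero, cons_val_one,
      cons_val_fin_one, zmod_three_table, if_true, if_false, zero_mul, mul_zero,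
      add_zero, zero_add, sub_zero, sub_self, zero_ne_one, one_ne_zero, mul_one, one_mul,
      ωpow_zero, ωpow_one, ωpow_two, map_zero, map_one, map_mul, map_pow, conj_ω,
      Complex.conj_ofReal]
    generalize (x : ℂ) = z
    generalize X 0 0 = a, X 0 1 = b, X 1 0 = c, X 1 1 = d
    repeat' apply And.intro
    all_goals grind

/-- The transfer matrix `t2` is Hermitian for real values of the spectral parameter. -/
theorem isHermitian_t2 (m : Boundary) (n : ℕ) (x : ℝ) : (t2 m n x).IsHermitian := by
  ext s u
  rw [conjTranspose_apply]
  cases m with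
  | periodic => exact conj_t2_periodic n x s u
  | braided => exact conj_t2_braided n x s u
  | openEnds => exact conj_t2_openEnds n x s u

/-- Conjugation interchanges ω - 1 with -(2 + ω) and negates 1 + 2ω, which amounts to exchanging the
two spectral parameters. -/
lemma conj_rcoef (z₁ z₂ : ℂ) (a j : ZMod 3) :
    starRingEnd ℂ (rcoef z₁ z₂ a j) = rcoef (starRingEnd ℂ z₂) (starRingEnd ℂ z₁) a j := by
  have h3 := ω_pow_three
  have hω := ω_sq_add
  revert a j
  simp only [rcoef_table, forall_zmod_three, map_one, map_mul, map_sub, map_add, conj_ω,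
    map_div₀, map_ofNat]
  repeat' apply And.intro
  all_goals grind

lemma Rmat_map_conj (z₁ z₂ : ℂ) :
    (Rmat z₁ z₂).map (starRingEnd ℂ) = Rmat (starRingEnd ℂ z₂) (starRingEnd ℂ z₁) := by
  ext ⟨β, t⟩ ⟨α, s⟩
  rw [map_apply, Rmat_apply, Rmat_apply, ← conj_rcoef]
  split_ifs
  · rfl
  · exact map_zero _

/-- The complex conjugate of the transfer matrix `t3`. -/
theorem t3_map_conj (m : Boundary) (n : ℕ) (z₁ z₂ : ℂ) :
    (t3 m n z₁ z₂).map (starRingEnd ℂ) = t3 m n (starRingEnd ℂ z₂) (starRingEnd ℂ z₁) := by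
  have key : ∀ M N : Matrix (ZMod 3 × ZMod 3) (ZMod 3 × ZMod 3) ℂ,
      (traceAux (prodDown n M * prodUp n N)).map (starRingEnd ℂ) =
        traceAux (prodDown n (M.map (starRingEnd ℂ)) * prodUp n (N.map (starRingEnd ℂ))) := by
    intro M N
    ext s u
    rw [map_apply, traceAux_prodDown_mul_prodUp, traceAux_prodDown_mul_prodUp, chain_map_conj,
      trace_map_conj]
  cases m with
  | periodic => rw [t3_periodic, t3_periodic, key, Rmat_map_conj, map_conj_one]
  | braided =>
    rw [t3, key, Rmat_map_conj, Rmat_map_conj, map_zero]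
    rfl
  | openEnds =>
    rw [t3, key, ← submatrix_map, Rmat_map_conj]
    rfl

/-! ### Polynomial dependence on the spectral parameter. -/

section Polynomiality

/-- The function `f` is given by a polynomial of degree at most `d`. -/
def IsPolyOfDegree (d : ℕ) (f : ℂ → ℂ) : Prop :=
  ∃ P : Polynomial ℂ, P.natDegree ≤ d ∧ ∀ z, f z = P.eval z

lemma isPolyOfDegree_const (d : ℕ) (c : ℂ) : IsPolyOfDegree d fun _ => c :=
  ⟨Polynomial.C c, by simp, by simp⟩

lemma isPolyOfDegree_affine (a b : ℂ) : IsPolyOfDegree 1 fun z => a * z + b :=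
  ⟨Polynomial.C a * Polynomial.X + Polynomial.C b, Polynomial.natDegree_linear_le, by simp⟩

lemma IsPolyOfDegree.mul {d e : ℕ} {f g : ℂ → ℂ} (hf : IsPolyOfDegree d f)
    (hg : IsPolyOfDegree e g) : IsPolyOfDegree (d + e) fun z => f z * g z := by
  obtain ⟨P, hP, hf⟩ := hf
  obtain ⟨Q, hQ, hg⟩ := hg
  exact ⟨P * Q, Polynomial.natDegree_mul_le_of_le hP hQ, fun z => by simp [hf, hg]⟩

lemma IsPolyOfDegree.sum {ι : Type*} {s : Finset ι} {d : ℕ} {f : ι → ℂ → ℂ}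
    (hf : ∀ i ∈ s, IsPolyOfDegree d (f i)) : IsPolyOfDegree d fun z => ∑ i ∈ s, f i z := by
  choose! P hP hf using hf
  refine ⟨∑ i ∈ s, P i, Polynomial.natDegree_sum_le_of_forall_le s P hP, fun z => ?_⟩
  rw [Polynomial.eval_finsetSum]
  exact Finset.sum_congr rfl fun i hi => hf i hi z

lemma isPolyOfDegree_chain {A : Type} [Fintype A] [DecidableEq A]
    {M N : ℂ → Matrix (A × ZMod 3) (A × ZMod 3) ℂ} {a b : ℕ}
    (hM : ∀ p q, IsPolyOfDegree a fun z => M z p q)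
    (hN : ∀ p q, IsPolyOfDegree b fun z => N z p q) (n : ℕ) (s u : Config n) (i j : A) :
    IsPolyOfDegree (n * (a + b)) fun z => chain (M z) (N z) n s u i j := by
  induction n generalizing i j with
  | zero => exact isPolyOfDegree_const _ _
  | succ n ih =>
    have e : (n + 1) * (a + b) = a + n * (a + b) + b := by ring
    simp only [chain, Matrix.sum_apply, mul_apply, e, Finset.sum_mul]
    exact IsPolyOfDegree.sum fun t _ => IsPolyOfDegree.sum fun k _ => IsPolyOfDegree.sum fun l _ =>
      ((hM _ _).mul (ih _ _ _ _)).mul (hN _ _)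

lemma isPolyOfDegree_transfer {A : Type} [Fintype A] [DecidableEq A]
    {M N : ℂ → Matrix (A × ZMod 3) (A × ZMod 3) ℂ} {a b : ℕ}
    (hM : ∀ p q, IsPolyOfDegree a fun z => M z p q)
    (hN : ∀ p q, IsPolyOfDegree b fun z => N z p q) (n : ℕ) (s u : Config n) :
    IsPolyOfDegree (n * (a + b)) fun z => traceAux (prodDown n (M z) * prodUp n (N z)) s u := by
  simp only [traceAux_prodDown_mul_prodUp, trace]
  exact IsPolyOfDegree.sum fun i _ => isPolyOfDegree_chain hM hN n s u i i

lemma isPolyOfDegree_Lop (p q : Fin 2 × ZMod 3) : IsPolyOfDegree 1 fun z => Lop z p q := by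
  obtain ⟨a, s⟩ := p
  obtain ⟨b, t⟩ := q
  simp only [Lop_apply]
  split_ifs <;> first | exact isPolyOfDegree_const _ _ | simpa using isPolyOfDegree_affine 1 0

lemma isPolyOfDegree_Lbar (p q : Fin 2 × ZMod 3) : IsPolyOfDegree 1 fun z => Lbar z p q := by
  obtain ⟨a, s⟩ := p
  obtain ⟨b, t⟩ := q
  simp only [Lbar_apply]
  split_ifs <;> first
    | exact isPolyOfDegree_const _ _
    | simpa [mul_comm] using isPolyOfDegree_affine (ωpow _) 0

lemma isPolyOfDegree_Rmat (z₂ : ℂ) (p q : ZMod 3 × ZMod 3) :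
    IsPolyOfDegree 1 fun z => Rmat z z₂ p q := by
  obtain ⟨β, t⟩ := p
  obtain ⟨α, s⟩ := q
  simp only [Rmat_apply]
  by_cases h : β + α = t + s
  · simp only [if_pos h, rcoef]
    have h1 : ∀ b, IsPolyOfDegree 1 fun z => wt₁ z b := by
      intro b
      unfold wt₁
      split_ifs
      · simpa [sub_eq_add_neg] using isPolyOfDegree_affine ω (-ω ^ 2)
      · simpa [sub_eq_add_neg] using isPolyOfDegree_affine 1 (-1)
    exact (isPolyOfDegree_const 0 _).mul (IsPolyOfDegree.sum (d := 0 + 1 + 0) fun b _ =>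
      ((isPolyOfDegree_const 0 _).mul (h1 b)).mul (isPolyOfDegree_const 0 _))
  · simp only [if_neg h]
    exact isPolyOfDegree_const _ _

lemma isPolyOfDegree_t2 (m : Boundary) (n : ℕ) (s u : Config n) :
    ∃ d, IsPolyOfDegree d fun z => t2 m n z s u := by
  cases m with
  | periodic =>
    simp only [t2_periodic]
    exact ⟨_, isPolyOfDegree_transfer (M := Lop) (N := fun _ => 1) isPolyOfDegree_Lop
      (fun _ _ => isPolyOfDegree_const 0 _) n s u⟩
  | braided =>
    simp only [t2]
    exact ⟨_, isPolyOfDegree_transfer (M := Lop) (N := fun _ => Lop 0) isPolyOfDegree_Lop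
      (fun _ _ => isPolyOfDegree_const 0 _) n s u⟩
  | openEnds =>
    simp only [t2]
    exact ⟨_, isPolyOfDegree_transfer (M := Lop) (N := Lbar) isPolyOfDegree_Lop
      isPolyOfDegree_Lbar n s u⟩

lemma isPolyOfDegree_t3 (m : Boundary) (n : ℕ) (z₂ : ℂ) (s u : Config n) :
    IsPolyOfDegree (degBound m n) fun z => t3 m n z z₂ s u := by
  have hR := isPolyOfDegree_Rmat z₂
  cases m with
  | periodic =>
    simp only [t3_periodic, degBound]
    have h := isPolyOfDegree_transfer (M := fun z => Rmat z z₂) (N := fun _ => 1) (b := 0) hR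
      (fun _ _ => isPolyOfDegree_const 0 _) n s u
    rwa [add_zero, mul_one] at h
  | braided =>
    simp only [t3, degBound]
    have h := isPolyOfDegree_transfer (M := fun z => Rmat z z₂) (N := fun _ => Rmat 0 0) (b := 0) hR
      (fun _ _ => isPolyOfDegree_const 0 _) n s u
    rwa [add_zero, mul_one] at h
  | openEnds =>
    simp only [t3, degBound]
    have h := isPolyOfDegree_transfer (M := fun z => Rmat z z₂)
      (N := fun z => (Rmat z z₂).submatrix Prod.swap Prod.swap) hR
      (fun p q => hR p.swap q.swap) n s u
    rwa [mul_comm] at h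

/-- The eigenvector does not depend on z, so μ is read off at one nonzero component as a fixed
linear combination of matrix entries. -/
lemma isPolyOfDegree_eigenvalue {ι : Type*} [Fintype ι] {T : ℂ → Matrix ι ι ℂ} {d : ℕ}
    (hT : ∀ i j, IsPolyOfDegree d fun z => T z i j) {u : ι → ℂ} (hu : u ≠ 0) {μ : ℂ → ℂ}
    (h : ∀ z, T z *ᵥ u = μ z • u) : IsPolyOfDegree d μ := by
  obtain ⟨i, hi⟩ := Function.ne_iff.mp hu
  have hμ : ∀ z, μ z = ∑ j, (T z i j) * (u j / u i) := fun z => by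
    have := congrFun (h z) i
    simp only [Pi.smul_apply, smul_eq_mul, mulVec, dotProduct] at this
    simp only [mul_div_assoc', ← Finset.sum_div]
    rw [this, mul_div_cancel_right₀ _ hi]
  rw [funext hμ]
  exact IsPolyOfDegree.sum fun j _ => (hT i j).mul (e := 0) (isPolyOfDegree_const 0 _)

lemma exists_polynomial_eigenvalue {m : Boundary} {n : ℕ} {lam : ℂ → ℂ}
    (h : lam ∈ eigenvalues m n) : ∃ P : Polynomial ℂ, ∀ z, lam z = P.eval z := by
  obtain ⟨u, hu, h⟩ := h
  choose d hd using isPolyOfDegree_t2 m n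
  obtain ⟨P, -, hP⟩ := isPolyOfDegree_eigenvalue (d := ∑ i, ∑ j, d i j) (fun i j => by
    obtain ⟨P, hP, h⟩ := hd i j
    refine ⟨P, hP.trans ?_, h⟩
    exact (Finset.single_le_sum (f := fun j => d i j) (fun _ _ => Nat.zero_le _)
      (Finset.mem_univ j)).trans (Finset.single_le_sum (f := fun i => ∑ j, d i j)
        (fun _ _ => Nat.zero_le _) (Finset.mem_univ i))) hu h
  exact ⟨P, hP⟩

end Polynomiality

open scoped ComplexOrder in
lemma eigenvalue_real {m : Boundary} {n : ℕ} {lam : ℂ → ℂ} (h : lam ∈ eigenvalues m n) (x : ℝ) :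
    starRingEnd ℂ (lam x) = lam x := by
  obtain ⟨u, hu, h⟩ := h
  have h1 : star u ⬝ᵥ (t2 m n x *ᵥ u) = lam x * (star u ⬝ᵥ u) := by
    rw [h, dotProduct_smul, smul_eq_mul]
  have h2 : star u ⬝ᵥ (t2 m n x *ᵥ u) = starRingEnd ℂ (lam x) * (star u ⬝ᵥ u) := by
    rw [dotProduct_mulVec, ← (isHermitian_t2 m n x).eq, ← star_mulVec, h, star_smul,
      smul_dotProduct,
      smul_eq_mul]
    rfl
  exact mul_right_cancel₀ (mt dotProduct_star_self_eq_zero.mp hu) (h2.symm.trans h1)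

lemma eval_ofReal_injective {P Q : Polynomial ℂ} (h : ∀ x : ℝ, P.eval (x : ℂ) = Q.eval (x : ℂ)) :
    P = Q :=
  Polynomial.eq_of_infinite_eval_eq P Q <|
    (Set.infinite_range_of_injective Complex.ofReal_injective).mono <| by
      rintro _ ⟨x, rfl⟩
      exact h x

lemma eval_conjPoly (P : Polynomial ℂ) (z : ℂ) :
    (conjPoly P).eval z = starRingEnd ℂ (P.eval (starRingEnd ℂ z)) := by
  rw [conjPoly, Polynomial.coe_mapRingHom, Polynomial.eval_map, ← Polynomial.eval₂_at_apply,
    Complex.conj_conj]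

/-! ### Integrality of t2 and its eigenvalues. -/

section Integrality

variable {Γ : Type*} [LinearOrderedCommGroupWithZero Γ] (v : Valuation ℂ Γ)

lemma valuation_chain_le_one {A : Type} [Fintype A] [DecidableEq A]
    {M N : Matrix (A × ZMod 3) (A × ZMod 3) ℂ}
    (hM : ∀ p q, v (M p q) ≤ 1) (hN : ∀ p q, v (N p q) ≤ 1) (n : ℕ) (s u : Config n) (i j : A) :
    v (chain M N n s u i j) ≤ 1 := by
  induction n generalizing i j with
  | zero =>
    rw [chain, one_apply]
    split_ifs <;> simp
  | succ n ih =>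
    simp only [chain, Matrix.sum_apply, mul_apply, Finset.sum_mul]
    refine v.map_sum_le fun t _ => v.map_sum_le fun k _ => v.map_sum_le fun l _ => ?_
    rw [map_mul, map_mul]
    exact mul_le_one' (mul_le_one' (hM _ _) (ih _ _ _ _)) (hN _ _)

lemma valuation_Lop_le_one {z : ℂ} (hz : v z ≤ 1) (p q : Fin 2 × ZMod 3) : v (Lop z p q) ≤ 1 := by
  obtain ⟨a, s⟩ := p
  obtain ⟨b, t⟩ := q
  rw [Lop_apply]
  split_ifs <;> simp [hz, ωpow, valuation_ω]

lemma valuation_Lbar_le_one {z : ℂ} (hz : v z ≤ 1) (p q : Fin 2 × ZMod 3) :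
    v (Lbar z p q) ≤ 1 := by
  obtain ⟨a, s⟩ := p
  obtain ⟨b, t⟩ := q
  rw [Lbar_apply]
  split_ifs <;> simp [hz, ωpow, valuation_ω]

/-- The local operators have only 0, 1, z, powers of ω and z times such powers as entries, hence
integral ones whenever z is integral. -/
lemma valuation_t2_le_one (m : Boundary) (n : ℕ) {z : ℂ} (hz : v z ≤ 1) (s u : Config n) :
    v (t2 m n z s u) ≤ 1 := by
  have h0 : v 0 ≤ 1 := by simp
  have key : ∀ N, (∀ p q, v (N p q) ≤ 1) →
      v (traceAux (prodDown n (Lop z) * prodUp n N) s u) ≤ 1 := by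
    intro N hN
    rw [traceAux_prodDown_mul_prodUp, trace]
    exact v.map_sum_le fun i _ => valuation_chain_le_one v (valuation_Lop_le_one v hz) hN n s u i i
  cases m with
  | periodic =>
    rw [t2_periodic]
    refine key 1 fun p q => ?_
    rw [one_apply]
    split_ifs <;> simp
  | braided => exact key _ (valuation_Lop_le_one v h0)
  | openEnds => exact key _ (valuation_Lbar_le_one v hz)

end Integrality

/-! ### Uniqueness of solutions of the TQ relation. -/

/-- The order to which `1 - z ^ 2` divides the coefficients of the TQ relation. -/
def edgeOrder : Boundary → ℕ
  | .periodic => 0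
  | .braided => 0
  | .openEnds => 1

/-- The relative sign of the coefficients of the TQ relation. -/
def edgeSign : Boundary → ℕ → ℂ
  | .periodic, n => (-1) ^ n
  | .braided, _ => 1
  | .openEnds, n => (-1) ^ n

/-- The factor by which a solution of the TQ relation has to be multiplied to remove the
denominators. -/
def edgeFactor (m : Boundary) : Polynomial ℂ :=
  (1 + Polynomial.C ω * Polynomial.X ^ 2) ^ edgeOrder m

lemma edgeFactor_ne_zero (m : Boundary) : edgeFactor m ≠ 0 := by
  refine pow_ne_zero _ fun h => ?_
  have := congrArg (Polynomial.eval 0) h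
  simp at this

lemma natDegree_edgeFactor (m : Boundary) : (edgeFactor m).natDegree ≤ 2 * edgeOrder m := by
  have h : (1 + Polynomial.C ω * Polynomial.X ^ 2 : Polynomial ℂ).natDegree ≤ 2 := by
    compute_degree
  exact (Polynomial.natDegree_pow_le_of_le _ h).trans (mul_comm _ _).le

lemma edgeSign_eq (m : Boundary) (n : ℕ) : edgeSign m n = 1 ∨ edgeSign m n = -1 := by
  cases m
  · exact neg_one_pow_eq_or ℂ n
  · exact Or.inl rfl
  · exact neg_one_pow_eq_or ℂ n

lemma infinite_isRegular (m : Boundary) : {z | IsRegular m z}.Infinite := by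
  cases m with
  | periodic => simpa [IsRegular] using Set.infinite_univ
  | braided => simpa [IsRegular] using Set.infinite_univ
  | openEnds =>
    have h : {z : ℂ | z ^ 4 = 1}.Finite := by
      refine (Polynomial.finite_setOfPred_isRoot
        (Polynomial.X_pow_sub_C_ne_zero (n := 4) (by norm_num) (1 : ℂ))).subset fun z hz => ?_
      simpa [sub_eq_zero] using hz
    exact h.infinite_compl

/-- For open ends the factor 1 + ωz² becomes 1 + z² at ωz and 1 + ω²z² at ω²z. The first completes 1
- z² to the denominator 1 - z⁴; the second, like the unrotated factor, absorbs part of a numerator.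
Infinitely many regular points suffice for a polynomial identity. -/
lemma TQ.isSolution {m : Boundary} {n : ℕ} {lam : ℂ → ℂ} {φ P : Polynomial ℂ}
    (h : TQ m n lam φ) (hP : ∀ z, lam z = P.eval z) :
    IsSolution (coeffF (edgeOrder m) (degBound m n)) (coeffG (edgeOrder m) (degBound m n)
      (edgeSign m n)) ((1 - Polynomial.X ^ 2) ^ edgeOrder m * P) (edgeFactor m * φ) := by
  refine Polynomial.eq_of_infinite_eval_eq _ _ ((infinite_isRegular m).mono fun z hz => ?_)
  have h := h z hz
  have h3 := ω_pow_three
  have e : ω * (ω * z) = ω ^ 2 * z := by ring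
  rw [hP] at h
  simp only [Set.mem_ofPred_eq, Polynomial.eval_mul, Polynomial.eval_add, eval_rot, coeffF, coeffG,
    edgeFactor, Polynomial.eval_pow, Polynomial.eval_sub, Polynomial.eval_one, Polynomial.eval_X,
    Polynomial.eval_C, e]
  cases m with
  | periodic =>
    simp only [edgeOrder, edgeSign, degBound, fcoef, gcoef, pow_zero, one_mul, mul_one] at h ⊢
    rw [h, ← mul_pow]
    ring
  | braided =>
    simp only [edgeOrder, edgeSign, degBound, fcoef, gcoef, pow_zero, one_mul] at h ⊢
    rw [h]
  | openEnds =>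
    have hz' : 1 - z ^ 4 ≠ 0 := sub_ne_zero.mpr (Ne.symm hz)
    simp only [edgeOrder, edgeSign, degBound, fcoef, gcoef, pow_one] at h ⊢
    field_simp at h
    have e1 : 1 + ω * (ω * z) ^ 2 = 1 + z ^ 2 := by linear_combination z ^ 2 * h3
    have e2 : 1 + ω * (ω ^ 2 * z) ^ 2 = 1 + ω ^ 2 * z ^ 2 := by
      linear_combination ω ^ 2 * z ^ 2 * h3
    have e3 : 1 - (ω ^ 2 * z) ^ 2 = 1 - ω * z ^ 2 := by linear_combination -ω * z ^ 2 * h3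
    rw [e1, e2, e3]
    linear_combination h

/-- Solutions of the TQ relation for an eigenvalue of `t2` are unique up to scalar multiples. -/
theorem TQ.unique {m : Boundary} {n : ℕ} {lam : ℂ → ℂ} (hlam : lam ∈ eigenvalues m n)
    {φ q : Polynomial ℂ} (hφ : TQ m n lam φ) (hq : TQ m n lam q) (hφ0 : φ ≠ 0)
    (hdφ : φ.natDegree ≤ degBound m n) (hdq : q.natDegree ≤ degBound m n) :
    ∃ c, q = Polynomial.C c * φ := by
  -- For the empty chain M = 0 and the degree bound for solutions is unavailable, but both
  -- polynomials are constants.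
  rcases Nat.eq_zero_or_pos (degBound m n) with h0 | hpos
  · rw [h0, Nat.le_zero] at hdφ hdq
    obtain ⟨a, rfl⟩ := Polynomial.natDegree_eq_zero.mp hdφ
    obtain ⟨b, rfl⟩ := Polynomial.natDegree_eq_zero.mp hdq
    have ha : a ≠ 0 := fun h => hφ0 (by rw [h, Polynomial.C_0])
    exact ⟨b / a, by rw [← Polynomial.C_mul, div_mul_cancel₀ _ ha]⟩
  · obtain ⟨P, hP⟩ := exists_polynomial_eigenvalue hlam
    have hsφ := hφ.isSolution hP
    have hsq := hq.isSolution hP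
    set F := coeffF (edgeOrder m) (degBound m n)
    set G := coeffG (edgeOrder m) (degBound m n) (edgeSign m n)
    set l := (1 - Polynomial.X ^ 2) ^ edgeOrder m * P with hl
    have hreal : conjPoly l = l := by
      have hPr : conjPoly P = P := eval_ofReal_injective fun x => by
        rw [eval_conjPoly, Complex.conj_ofReal, ← hP, eigenvalue_real hlam]
      rw [hl, map_mul, hPr, map_pow, map_sub, map_one, map_pow]
      congr 4
      simp [conjPoly]
    obtain ⟨B, hB⟩ := exists_valuation_two_lt_one
    have hint : ∀ a, B.valuation a ≤ 1 → B.valuation (l.eval a) ≤ 1 := by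
      intro a ha
      obtain ⟨u, hu, h⟩ := hlam
      rw [hl, Polynomial.eval_mul, map_mul, ← hP]
      refine mul_le_one' ?_ (valuation_eigenvalue_le_one _
        (fun i j => valuation_t2_le_one _ m n ha i j) hu (h a))
      rw [Polynomial.eval_pow, map_pow]
      refine pow_le_one' ?_ _
      rw [Polynomial.eval_sub, Polynomial.eval_one, Polynomial.eval_pow, Polynomial.eval_X]
      refine (B.valuation.map_sub _ _).trans (max_le (by simp) ?_)
      rw [map_pow]
      exact pow_le_one' ha 2
    have hδ := edgeSign_eq m n
    have hδ2 : edgeSign m n ^ 2 = 1 := by rcases hδ with h | h <;> rw [h] <;> norm_num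
    have hgap : gap F G ≠ 0 := by
      rw [gap_coeff hδ2, Ne, Polynomial.expand_eq_zero (by norm_num)]
      exact (cubicGap_degree hδ hpos.ne').1
    have hne : edgeFactor m * φ ≠ 0 := mul_ne_zero (edgeFactor_ne_zero m) hφ0
    classical
    have hex : ∃ d, ∃ χ, IsSolution F G l χ ∧ χ ≠ 0 ∧ χ.natDegree = d := ⟨_, _, hsφ, hne, rfl⟩
    obtain ⟨χ, hχ, hχ0, hχd⟩ := Nat.find_spec hex
    have hmin : ∀ p, IsSolution F G l p → p ≠ 0 → χ.natDegree ≤ p.natDegree := by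
      intro p hp hp0
      rw [hχd]
      exact Nat.find_min' hex ⟨p, hp, hp0, rfl⟩
    have hle := hχ.le_natDegree hχ0 hδ hpos.ne' hreal _ hB hint
    -- Clearing denominators raises the degree by at most 2ε, so p lands within two of the minimal
    -- degree, inside the window of `IsSolution.eq_C_mul_of_minimal`.
    have hdeg : ∀ p : Polynomial ℂ, p.natDegree ≤ degBound m n →
        (edgeFactor m * p).natDegree < χ.natDegree + 3 := by
      intro p hp
      have := Polynomial.natDegree_mul_le_of_le (natDegree_edgeFactor m) hp
      omega
    obtain ⟨a, ha⟩ := hχ.eq_C_mul_of_minimal hχ0 hmin hgap hsφ (hdeg φ hdφ)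
    obtain ⟨b, hb⟩ := hχ.eq_C_mul_of_minimal hχ0 hmin hgap hsq (hdeg q hdq)
    have ha0 : a ≠ 0 := by
      rintro rfl
      rw [Polynomial.C_0, zero_mul] at ha
      exact hne ha
    refine ⟨b / a, mul_left_cancel₀ (edgeFactor_ne_zero m) ?_⟩
    rw [hb, mul_left_comm, ha, ← mul_assoc, ← Polynomial.C_mul, div_mul_cancel₀ _ ha0]

/-- As a function of its first parameter, an eigenvalue of `t3` is proportional to the solution of
the TQ relation. -/
theorem exists_eigenvalue_t3_eq {m : Boundary} {n : ℕ} {lam : ℂ → ℂ} {φ : Polynomial ℂ}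
    (hφ : TQ m n lam φ) (hφ0 : φ ≠ 0) (hd : φ.natDegree ≤ degBound m n) {v : Config n → ℂ}
    (hv : v ≠ 0) (h2 : ∀ z, t2 m n z *ᵥ v = lam z • v) {Λ : ℂ → ℂ → ℂ}
    (h3 : ∀ z₁ z₂, t3 m n z₁ z₂ *ᵥ v = Λ z₁ z₂ • v) (z₂ : ℂ) :
    ∃ c, ∀ z₁, Λ z₁ z₂ = c * φ.eval z₁ := by
  obtain ⟨q, hdq, hq⟩ := isPolyOfDegree_eigenvalue (T := fun z => t3 m n z z₂)
    (isPolyOfDegree_t3 m n z₂) hv fun z => h3 z z₂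
  have hTQ : TQ m n lam q := by
    intro z hz
    have h := congrArg (· *ᵥ v) (t2_mul_t3 m n hz z₂)
    simp only [← mulVec_mulVec, add_mulVec, smul_mulVec, h3, mulVec_smul, h2, smul_smul] at h
    obtain ⟨i, hi⟩ := Function.ne_iff.mp hv
    have h' := congrFun h i
    simp only [Pi.add_apply, Pi.smul_apply, smul_eq_mul, ← add_mul] at h'
    have h'' := mul_right_cancel₀ hi h'
    rw [← hq, ← hq, ← hq]
    linear_combination h''
  obtain ⟨c, rfl⟩ := TQ.unique ⟨v, hv, h2⟩ hφ hTQ hφ0 hd hdq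
  exact ⟨c, fun z₁ => by rw [show Λ z₁ z₂ = _ from hq z₁, Polynomial.eval_mul, Polynomial.eval_C]⟩

lemma mulVec_map_conj {ι : Type*} [Fintype ι] (M : Matrix ι ι ℂ) (v : ι → ℂ) :
    M.map (starRingEnd ℂ) *ᵥ star v = star (M *ᵥ v) := by
  ext i
  simp [mulVec, dotProduct]

/-- The eigenvector equation for `t2` extends from real to complex spectral parameters. -/
lemma t2_mulVec_eq_of_real {m : Boundary} {n : ℕ} {lam : ℂ → ℂ} {w : Config n → ℂ}
    (hlam : lam ∈ eigenvalues m n) (h : ∀ x : ℝ, t2 m n x *ᵥ w = lam x • w) (z : ℂ) :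
    t2 m n z *ᵥ w = lam z • w := by
  obtain ⟨P, hP⟩ := exists_polynomial_eigenvalue hlam
  ext i
  choose d T hT hT' using fun j => isPolyOfDegree_t2 m n i j
  have e : ∀ z, (t2 m n z *ᵥ w) i = (∑ j, T j * Polynomial.C (w j)).eval z := by
    intro z
    rw [Polynomial.eval_finsetSum]
    refine Finset.sum_congr rfl fun j _ => ?_
    rw [Polynomial.eval_mul, Polynomial.eval_C, ← hT' j]
  have e' : ∀ z, (lam z • w) i = (P * Polynomial.C (w i)).eval z := by
    intro z
    rw [Polynomial.eval_mul, Polynomial.eval_C, ← hP, Pi.smul_apply, smul_eq_mul]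
  have hPQ : ∑ j, T j * Polynomial.C (w j) = P * Polynomial.C (w i) :=
    eval_ofReal_injective fun x => by rw [← e, ← e', h]
  rw [e, e', hPQ]

end AnyonChain

end

/-! ### Separation of the two variables. -/

theorem mainTheorem1 (m : AnyonChain.Boundary) (n : ℕ)
    (lamj lamk : ℂ → ℂ)
    (hj : lamj ∈ AnyonChain.eigenvalues m n) (hk : lamk ∈ AnyonChain.eigenvalues m n)
    (φj φk : Polynomial ℂ) (hφj : φj.Monic) (hφk : φk.Monic)
    (hdj : φj.natDegree ≤ AnyonChain.degBound m n)
    (hdk : φk.natDegree ≤ AnyonChain.degBound m n)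
    (hTQj : AnyonChain.TQ m n lamj φj) (hTQk : AnyonChain.TQ m n lamk φk)
    (v : AnyonChain.Config n → ℂ) (hv : v ≠ 0) (Λ : ℂ → ℂ → ℂ)
    (h2 : ∀ z : ℂ, (AnyonChain.t2 m n z).mulVec v = lamj z • v)
    (h2conj : ∀ x : ℝ,
      ((AnyonChain.t2 m n (x : ℂ)).map (starRingEnd ℂ)).mulVec v = lamk (x : ℂ) • v)
    (h3 : ∀ z₁ z₂ : ℂ, (AnyonChain.t3 m n z₁ z₂).mulVec v = Λ z₁ z₂ • v) :
    ∃ c : ℂ, ∀ x₁ x₂ : ℝ,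
      Λ (x₁ : ℂ) (x₂ : ℂ) =
        c * φj.eval (x₁ : ℂ) * (starRingEnd ℂ) (φk.eval (x₂ : ℂ)) := by
  have hw : star v ≠ 0 := star_ne_zero.mpr hv
  obtain ⟨x₀, hx₀⟩ : ∃ x : ℝ, φj.eval (x : ℂ) ≠ 0 := by
    by_contra! h
    exact hφj.ne_zero (AnyonChain.eval_ofReal_injective fun x => by rw [h, Polynomial.eval_zero])
  -- Conjugating `h2conj` makes `star v` an eigenvector of t2 for real parameters, with eigenvalue
  -- λ_k because λ_k is real there; polynomiality extends this to all z.
  have h2w : ∀ z : ℂ, (AnyonChain.t2 m n z).mulVec (star v) = lamk z • star v := by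
    refine AnyonChain.t2_mulVec_eq_of_real hk fun x => ?_
    have h := AnyonChain.mulVec_map_conj ((AnyonChain.t2 m n (x : ℂ)).map (starRingEnd ℂ)) v
    have e : ((AnyonChain.t2 m n (x : ℂ)).map (starRingEnd ℂ)).map (starRingEnd ℂ) =
        AnyonChain.t2 m n (x : ℂ) := by
      ext
      simp
    rw [e, h2conj, star_smul] at h
    rw [h]
    congr 1
    exact AnyonChain.eigenvalue_real hk x
  have h3w : ∀ z₁ z₂ : ℂ, (AnyonChain.t3 m n z₁ z₂).mulVec (star v) =
      (starRingEnd ℂ) (Λ ((starRingEnd ℂ) z₂) ((starRingEnd ℂ) z₁)) • star v := by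
    intro z₁ z₂
    have h := AnyonChain.mulVec_map_conj
      (AnyonChain.t3 m n ((starRingEnd ℂ) z₂) ((starRingEnd ℂ) z₁)) v
    rw [AnyonChain.t3_map_conj, Complex.conj_conj, Complex.conj_conj, h3, star_smul] at h
    exact h
  choose a ha using AnyonChain.exists_eigenvalue_t3_eq hTQj hφj.ne_zero hdj hv h2 h3
  choose b hb using AnyonChain.exists_eigenvalue_t3_eq hTQk hφk.ne_zero hdk hw h2w h3w
  have hb' : ∀ x₁ x₂ : ℝ, Λ (x₁ : ℂ) (x₂ : ℂ) =
      (starRingEnd ℂ) (b x₁) * (starRingEnd ℂ) (φk.eval (x₂ : ℂ)) := by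
    intro x₁ x₂
    have h := congrArg (starRingEnd ℂ) (hb x₁ x₂)
    rwa [Complex.conj_ofReal, Complex.conj_ofReal, Complex.conj_conj, map_mul] at h
  -- Λ equals both a(x₂) φ_j(x₁) and b(x₁)* φ_k(x₂)*. Comparing at x₁ = x₀, where φ_j does not
  -- vanish, determines a(x₂) and hence c.
  refine ⟨(starRingEnd ℂ) (b x₀) / φj.eval (x₀ : ℂ), fun x₁ x₂ => ?_⟩
  have h0 := (ha x₂ x₀).symm.trans (hb' x₀ x₂)
  rw [ha, div_mul_eq_mul_div, div_mul_eq_mul_div, eq_div_iff hx₀]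
  linear_combination φj.eval (x₁ : ℂ) * h0
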